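/- **Theorem (vORAM stash size).** A *vORAM* of height $T\ge 0$ with collision parameter $\gamma\ge 0$ and bucket size $Z$ is a complete binary tree of buckets with levels $0,\dots,T$, together with a stash. Every bucket can hold (parts of) blocks of total length at most $Z$ (keys, identifiers and length fields are not counted); $|\mathrm{stash}|$ is the total length of the block parts in the stash. Each stored block has an identifier, a string of $2T+\gamma+1$ bits of which the first is $1$ and the others are random; its first $T+1$ bits encode a path from the root to a leaf. To *evict* a path means to move all block parts in its buckets to the stash, merging parts with the same identifier. To *write back* a path means to go through its buckets from the leaf to the root and, as long as the current bucket is not full and the stash contains a part of a block whose own path goes through this bucket, to choose an arbitrary such part and move its largest piece that fits into the bucket. The vORAM is initially empty, and the possible accesses are: * insert: evict the path of a freshly generated identifier, put the new block with another freshly generated identifier into the stash, and write back the evicted path; * remove a stored block: evict the path of its identifier, delete everything with this identifier from the stash, and write back the path; * update a stored block: as remove, but before writing back put the new version of the block with a freshly generated identifier into the stash. Consider any fixed sequence of accesses that removes and updates only currently stored blocks. Suppose that all generated identifiers are independent, uniformly distributed (apart from the fixed first bit), and independent of the block lengths; that the length $l$ of each block is a random non-negative integer with $$\mathbb{E}[l]=B\quad\text{and}\quad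 \Pr[l>mB]<0.5^m\ \text{ for all integers } m\ge 1;$$ and that the lengths of the blocks stored after the last access are independent. If $Z\ge 20B$ and at most $n=2^T$ blocks are stored after the last access, then for every real $R\ge 1$, after the last access and whatever arbitrary choices were made in the write-backs, $$\Pr\big[\,|\mathrm{stash}|>R\,B\,\big]<28\cdot(0.883)^R.$$ -/

import Mathlib

namespace VORAM

/-- Identifiers of a vORAM of height `T` with collision parameter `γ`: the `2 T + γ` random bits
that follow the fixed leading bit `1`. -/
abbrev Ident (T γ : ℕ) : Type := Fin (2 * T + γ) → Bool

variable {T γ : ℕ}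

/-- The node at level `t` on the path from the root to the leaf encoded by `x`. A node of level `t`
is named by a bit string of length `t` (the root is the empty string), so the name consists of the
`t` bits of the identifier after the leading `1`. -/
def loc (x : Ident T γ) (t : ℕ) : List Bool := (List.ofFn x).take t

/-- The buckets on the path encoded by `x`, levels `0, …, T`. -/
def path (x : Ident T γ) : Finset (List Bool) :=
  (Finset.range (T + 1)).image (loc x)

/-- A collection of partial blocks, at most one for each identifier, recorded by their lengths;
length `0` means that there is no partial block with that identifier. -/
abbrev Store (T γ : ℕ) : Type := Ident T γ → ℕ

/-- Total length of the partial blocks in a collection. -/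
def Store.size (b : Store T γ) : ℕ := ∑ x, b x

/-- The state of a vORAM: the partial blocks in the stash and in every bucket of the tree.
The contents of the blocks and the encryption keys are irrelevant to all sizes. -/
structure State (T γ : ℕ) where
  stash : Store T γ
  bucket : List Bool → Store T γ

/-- The vORAM that stores nothing. -/
def State.empty : State T γ where
  stash := fun _ => 0
  bucket := fun _ _ => 0

/-- `evict x`: empty all the buckets on the path of `x`, and move their partial blocks to the
stash, merging partial blocks that share an identifier. -/
def State.evict (s : State T γ) (x : Ident T γ) : State T γ where
  stash := fun y => s.stash y + ∑ t ∈ Finset.range (T + 1), s.bucket (loc x t) y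
  bucket := fun v => if v ∈ path x then (fun _ => 0) else s.bucket v

/-- Insert a block with identifier `x` and length `l` into the stash. -/
def State.put (s : State T γ) (x : Ident T γ) (l : ℕ) : State T γ where
  stash := Function.update s.stash x (s.stash x + l)
  bucket := s.bucket

/-- Remove the block with identifier `x` from the stash. -/
def State.delete (s : State T γ) (x : Ident T γ) : State T γ where
  stash := Function.update s.stash x 0
  bucket := s.bucket

/-- The loop that fills the bucket `v` of level `t`, which can hold block data of total length `Z`.
`Pack Z v t st b st' b'` says that the loop, started with stash `st` and bucket contents `b`, can
terminate with stash `st'` and bucket contents `b'`.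

As long as there is a partial block in the stash that may be stored in `v` and the bucket is not
full, an arbitrary such partial block is chosen and its largest part that fits is moved to the
bucket; the rest, if any, stays in the stash. -/
inductive Pack (Z : ℕ) (v : List Bool) (t : ℕ) :
    Store T γ → Store T γ → Store T γ → Store T γ → Prop
  | done (st b : Store T γ)
      (h : (∀ y, loc y t = v → st y = 0) ∨ Z ≤ b.size) :
      Pack Z v t st b st b
  | step (st b st' b' : Store T γ) (y : Ident T γ) (hy : loc y t = v) (hpos : 0 < st y)
      (hroom : b.size < Z)
      (h : Pack Z v t
        (Function.update st y (st y - min (st y) (Z - b.size)))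
        (Function.update b y (b y + min (st y) (Z - b.size))) st' b') :
      Pack Z v t st b st' b'

/-- Rewriting the bucket of level `t` on the path of `x`, starting from an empty bucket. -/
def FillLevel (Z : ℕ) (x : Ident T γ) (t : ℕ) (s s' : State T γ) : Prop :=
  Pack Z (loc x t) t s.stash (fun _ => 0) s'.stash (s'.bucket (loc x t)) ∧
    ∀ v, v ≠ loc x t → s'.bucket v = s.bucket v

/-- Rewriting the buckets of levels `t, t - 1, …, 0` on the path of `x`, in this order. -/
def WritebackFrom (Z : ℕ) (x : Ident T γ) : ℕ → State T γ → State T γ → Prop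
  | 0, s, s' => FillLevel Z x 0 s s'
  | t + 1, s, s' => ∃ s₁, FillLevel Z x (t + 1) s s₁ ∧ WritebackFrom Z x t s₁ s'

/-- `writeback x`, from the leaf to the root; `s'` is a possible result when started from `s`. -/
def Writeback (Z : ℕ) (x : Ident T γ) (s s' : State T γ) : Prop :=
  WritebackFrom Z x T s s'

/-- The accesses. A stored block is named by the position, in the sequence of accesses, of the
`insert` or `update` that returned its current identifier. -/
inductive Access where
  | insert
  | remove (j : ℕ)
  | update (j : ℕ)

/-- `Access.Exec Z ids len i a s s'`: access `a`, at position `i` of the sequence, can lead from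
state `s` to state `s'`. The identifiers generated by the access at position `i` are
`ids (i, true)`, the one returned for the block that the access stores, and `ids (i, false)`, whose
path an `insert` evicts; `len i` is the length of the block that the access stores (for an
`update`, the block returned by the callback). -/
def Access.Exec (Z : ℕ) (ids : ℕ × Bool → Ident T γ) (len : ℕ → ℕ) (i : ℕ) :
    Access → State T γ → State T γ → Prop
  | .insert, s, s' =>
      Writeback Z (ids (i, false))
        ((s.evict (ids (i, false))).put (ids (i, true)) (len i)) s'
  | .remove j, s, s' =>
      Writeback Z (ids (j, true))
        ((s.evict (ids (j, true))).delete (ids (j, true))) s'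
  | .update j, s, s' =>
      Writeback Z (ids (j, true))
        (((s.evict (ids (j, true))).delete (ids (j, true))).put (ids (i, true)) (len i)) s'

/-- The blocks stored after the first `k` accesses. -/
def live (ops : ℕ → Access) : ℕ → Finset ℕ
  | 0 => ∅
  | i + 1 =>
    match ops i with
    | .insert => insert i (live ops i)
    | .remove j => (live ops i).erase j
    | .update j => insert i ((live ops i).erase j)

/-- Only blocks that are currently stored are removed or updated, by the first `k` accesses. -/
def Valid (ops : ℕ → Access) (k : ℕ) : Prop :=
  ∀ i < k, match ops i with
    | .insert => True
    | .remove j => j ∈ live ops i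
    | .update j => j ∈ live ops i

/-- `s 0, …, s k` are the states of a vORAM, initially empty and with bucket size `Z`, in an
execution of the first `k` accesses. -/
def IsRun (Z : ℕ) (ops : ℕ → Access) (k : ℕ) (ids : ℕ × Bool → Ident T γ) (len : ℕ → ℕ)
    (s : ℕ → State T γ) : Prop :=
  s 0 = State.empty ∧ ∀ i < k, (ops i).Exec Z ids len i (s i) (s (i + 1))

end VORAM

/-!
The proof compares the vORAM with one whose buckets are unbounded. There, a block stored at some
time ends at the deepest node that its path shares with a path evicted since then. Let `τ` be the
tree of the full buckets all of whose ancestors are full. Whatever is in the stash or in `τ` belongs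
to blocks that unbounded buckets would hold within `τ` (`IsRun.exists_subtree`), so
`|stash| + |τ| Z` is at most their total length. This rests on `StashInv`, an invariant of single
buckets that are not full, which holds for every choice in the write-backs and in spite of colliding
identifiers. Only the evictions made when the blocks stored at the end were created are needed:
disregarding the others can only enlarge the load of a tree that contains the root.

It remains to bound, for a fixed tree `τ` with `m` nodes, the probability of a total length above
`(R + 20 m) B`. The identifiers of the stored blocks and the paths evicted at their creation are
pairwise distinct members of the family of generated identifiers (`blockKey_injOn`), hence
independent and uniform. Given them, Chernoff's bound applies to the lengths
(`measureReal_lt_sum_le`), with exponential moments bounded through the geometric tails alone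
(`lintegral_exp_le`). The moment generating function of the number of blocks in `τ` is bounded by
`(1 - δ)⁻¹ ^ (2 m)` at `1 + δ`: going back in time, every node at which paths leave `τ` holds a
geometric number of blocks, and every leaf in `τ` at most a Poisson number
(`sum_prod_stuckAt_le`, `sum_prod_stuckAt_exitNode_le`).

Finally, the bounds are added over all subtrees. With `exp t = 1 / 0.883`, the moment of a length at
`t / B` is at most `1 + δ = exp t / (2 - exp t)`, each node contributes a factor
`w = 0.883 ^ 20 * (1 - δ)⁻¹ ^ 2`, and `w < 0.173` is small enough for the sum of
`w ^ m` to be controlled by the quadratic recursion for binary trees (`sum_subtrees_le`).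
-/

namespace VORAM

section

variable {T γ : ℕ}

/-! ### Nodes on a path -/

theorem length_loc (x : Ident T γ) {t : ℕ} (ht : t ≤ T) : (loc x t).length = t := by
  simp [loc]; omega

theorem take_loc (x : Ident T γ) {i t : ℕ} (h : i ≤ t) : (loc x t).take i = loc x i := by
  simp [loc, List.take_take, h]

theorem loc_eq_of_le {x y : Ident T γ} {i t : ℕ} (h : i ≤ t) (hxy : loc x t = loc y t) :
    loc x i = loc y i := by
  rw [← take_loc x h, ← take_loc y h, hxy]

theorem eq_level_of_loc_eq {x y : Ident T γ} {i t : ℕ} (hi : i ≤ T) (ht : t ≤ T)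
    (h : loc x i = loc y t) : i = t := by
  rw [← length_loc x hi, ← length_loc y ht, h]

theorem mem_path {x : Ident T γ} {v : List Bool} : v ∈ path x ↔ ∃ t ≤ T, loc x t = v := by
  simp [path]

/-! ### Write-back -/

/-- What filling one bucket guarantees: no data is created or lost, data only arrives with
identifiers whose path passes through the bucket, and the loop stops only when the bucket is full or
no such data remains in the stash. -/
theorem Pack.spec {Z : ℕ} {v : List Bool} {t : ℕ} {st b st' b' : Store T γ}
    (h : Pack Z v t st b st' b') :
    (∀ y, st' y + b' y = st y + b y) ∧ (∀ y, loc y t ≠ v → b' y = b y) ∧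
      (b'.size < Z → ∀ y, loc y t = v → st' y = 0) := by
  induction h with
  | done st b h =>
    refine ⟨fun _ => rfl, fun _ _ => rfl, fun hlt => ?_⟩
    rcases h with h | h
    · exact h
    · omega
  | step st b st' b' y hy hpos hroom _ ih =>
    obtain ⟨h1, h2, h3⟩ := ih
    refine ⟨fun z => ?_, fun z hz => ?_, h3⟩
    · rw [h1 z]
      by_cases hzy : z = y
      · subst hzy
        simp only [Function.update_self]
        omega
      · simp [Function.update_of_ne hzy]
    · have hzy : z ≠ y := fun h => hz (h ▸ hy)
      rw [h2 z hz, Function.update_of_ne hzy]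

/-- What writing back a path guarantees, level by level: buckets off the path do not change, no data
is created or lost, data is only placed on its own path, and a bucket that does not get full leaves
nothing above itself that could have been stored in it. -/
theorem WritebackFrom.spec {Z : ℕ} {x : Ident T γ} {t : ℕ} (ht : t ≤ T) {s s' : State T γ}
    (h : WritebackFrom Z x t s s') :
    (∀ v, (∀ i ≤ t, v ≠ loc x i) → s'.bucket v = s.bucket v) ∧
    (∀ y, s'.stash y + ∑ i ∈ Finset.range (t + 1), s'.bucket (loc x i) y = s.stash y) ∧
    (∀ y, ∀ i ≤ t, s'.bucket (loc x i) y ≠ 0 → loc y i = loc x i) ∧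
    (∀ y, ∀ i ≤ t, loc y i = loc x i → (s'.bucket (loc x i)).size < Z →
      s'.stash y + ∑ i' ∈ Finset.range i, s'.bucket (loc x i') y = 0) := by
  induction t generalizing s with
  | zero =>
    obtain ⟨hp, hb⟩ := h
    obtain ⟨h1, h2, h3⟩ := hp.spec
    refine ⟨fun v hv => hb v (hv 0 le_rfl), fun y => by simpa using h1 y, ?_, ?_⟩
    · intro y i hi hne
      obtain rfl : i = 0 := by omega
      by_contra hy
      exact hne (h2 y hy)
    · intro y i hi hy hlt
      obtain rfl : i = 0 := by omega
      simpa using h3 hlt y hy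
  | succ t ih =>
    obtain ⟨s₁, ⟨hp, hb⟩, hw⟩ := h
    obtain ⟨h1, h2, h3⟩ := hp.spec
    obtain ⟨i1, i2, i3, i4⟩ := ih (by omega) hw
    have hkeep : s'.bucket (loc x (t + 1)) = s₁.bucket (loc x (t + 1)) := by
      refine i1 _ fun i hi he => ?_
      have := eq_level_of_loc_eq ht (by omega) he
      omega
    refine ⟨fun v hv => ?_, fun y => ?_, fun y i hi hne => ?_, fun y i hi hy hlt => ?_⟩
    · rw [i1 v fun i hi => hv i (by omega), hb v (hv (t + 1) le_rfl)]
    · rw [Finset.sum_range_succ, ← add_assoc, i2 y, hkeep, h1 y]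
      simp
    · rcases Nat.lt_or_ge t i with hti | hti
      · obtain rfl : i = t + 1 := by omega
        by_contra hy
        rw [hkeep] at hne
        exact hne (h2 y hy)
      · exact i3 y i hti hne
    · rcases Nat.lt_or_ge t i with hti | hti
      · obtain rfl : i = t + 1 := by omega
        rw [hkeep] at hlt
        rw [i2 y]
        exact h3 hlt y hy
      · exact i4 y i hti hy hlt

/-- The amount of data with identifier `y` in the stash and in the buckets above level `h`. -/
def State.above (s : State T γ) (y : Ident T γ) (h : ℕ) : ℕ :=
  s.stash y + ∑ t ∈ Finset.range h, s.bucket (loc y t) y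

/-- Every bucket only holds data whose path passes through it. -/
def State.OnPath (s : State T γ) : Prop :=
  ∀ v y, s.bucket v y ≠ 0 → ∃ t ≤ T, v = loc y t

/-- If the path of `x` avoids the node of level `h` on the path of `y` (or `h` exceeds all levels),
then emptying the path of `x` into the stash takes data with identifier `y` only from buckets above
level `h`. -/
theorem sum_range_path_eq {b : List Bool → Store T γ} {x y : Ident T γ}
    (hon : ∀ t ≤ T, b (loc x t) y ≠ 0 → loc y t = loc x t) {h : ℕ} (hT : h ≤ T + 1)
    (hh : h ≤ T → loc x h ≠ loc y h) :
    ∑ t ∈ Finset.range (T + 1), b (loc x t) y =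
      ∑ t ∈ Finset.range h, if loc y t = loc x t then b (loc y t) y else 0 := by
  rw [← Finset.sum_subset (Finset.range_subset_range.2 hT)]
  · refine Finset.sum_congr rfl fun t ht => ?_
    rw [Finset.mem_range] at ht
    split_ifs with he
    · rw [he]
    · by_contra hne
      exact he (hon t (by omega) hne)
  · intro t ht htn
    rw [Finset.mem_range] at ht htn
    by_contra hne
    exact hh (by omega) (loc_eq_of_le (not_lt.1 htn) (hon t (by omega) hne)).symm

/-- The effect of a general access on the state: evicting the path of `x`, changing the stash, and
writing the path back, seen from an identifier `y`. Nothing of `y` is left above a bucket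
on both paths that is not full; and for a level `h` at which the two paths have separated, the
amount of `y` above level `h` changes only by the change of the stash. -/
theorem above_of_writeback {Z : ℕ} {x : Ident T γ} {s s₁ s' : State T γ} (hs : s.OnPath)
    (hb : s₁.bucket = (s.evict x).bucket) (hw : Writeback Z x s₁ s') :
    s'.OnPath ∧
    (∀ y, ∀ h ≤ T, loc x h = loc y h → (s'.bucket (loc y h)).size < Z → s'.above y h = 0) ∧
    (∀ v, v ∉ path x → s'.bucket v = s.bucket v) ∧
    (∀ y, ∀ h ≤ T + 1, (h ≤ T → loc x h ≠ loc y h) →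
      s'.above y h + (s.evict x).stash y = s.above y h + s₁.stash y) := by
  obtain ⟨w1, w2, w3, w4⟩ := WritebackFrom.spec le_rfl hw
  have hoff : ∀ v, v ∉ path x → s'.bucket v = s.bucket v := by
    intro v hv
    rw [w1 v, hb]
    · simp [State.evict, hv]
    · rintro i hi rfl
      exact hv (mem_path.2 ⟨i, hi, rfl⟩)
  refine ⟨?_, ?_, hoff, ?_⟩
  · intro v y hne
    by_cases hv : v ∈ path x
    · obtain ⟨t, ht, rfl⟩ := mem_path.1 hv
      exact ⟨t, ht, (w3 y t ht hne).symm⟩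
    · rw [hoff v hv] at hne
      exact hs v y hne
  · intro y h hh he hlt
    have := w4 y h hh he.symm (by rwa [he])
    rw [State.above, ← this]
    congr 1
    refine Finset.sum_congr rfl fun t ht => ?_
    rw [loc_eq_of_le (Finset.mem_range.1 ht).le he]
  · intro y h hT hh
    have e1 := sum_range_path_eq (b := s'.bucket) (w3 y) hT hh
    have e2 := sum_range_path_eq (b := s.bucket) (x := x) (y := y) (fun t ht hne => by
      obtain ⟨t', ht', he⟩ := hs _ _ hne
      have := eq_level_of_loc_eq ht ht' he
      subst this
      exact he.symm) hT hh
    have e3 : ∀ b : List Bool → Store T γ, ∑ t ∈ Finset.range h, b (loc y t) y =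
        (∑ t ∈ Finset.range h, if loc y t = loc x t then b (loc y t) y else 0) +
        ∑ t ∈ Finset.range h, if loc y t = loc x t then 0 else b (loc y t) y := by
      intro b
      rw [← Finset.sum_add_distrib]
      refine Finset.sum_congr rfl fun t _ => ?_
      split_ifs <;> simp
    have e4 : (∑ t ∈ Finset.range h, if loc y t = loc x t then 0 else s'.bucket (loc y t) y) =
        ∑ t ∈ Finset.range h, if loc y t = loc x t then 0 else s.bucket (loc y t) y := by
      refine Finset.sum_congr rfl fun t ht => ?_
      split_ifs with he
      · rfl
      · rw [hoff]
        intro hm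
        obtain ⟨i, hi, he'⟩ := mem_path.1 hm
        rcases eq_or_ne t (T + 1) with htT | htT
        · have := Finset.mem_range.1 ht
          omega
        · have htl : t ≤ T := by have := Finset.mem_range.1 ht; omega
          have := eq_level_of_loc_eq hi htl he'
          subst this
          exact he he'.symm
    have e5 := w2 y
    simp only [State.above, State.evict]
    rw [e3 s'.bucket, e3 s.bucket, e2, ← e5, e1, e4]
    omega

/-! ### The invariant for buckets that are not full -/

/-- The identifier whose path is evicted by the access at position `i`, as an index into the family
of all generated identifiers. -/
def evictKey (ops : ℕ → Access) (i : ℕ) : ℕ × Bool :=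
  match ops i with
  | .insert => (i, false)
  | .remove j => (j, true)
  | .update j => (j, true)

theorem live_lt (ops : ℕ → Access) {k j : ℕ} (h : j ∈ live ops k) : j < k := by
  induction k with
  | zero => simp [live] at h
  | succ k ih =>
    simp only [live] at h
    split at h
    · rcases Finset.mem_insert.1 h with h | h
      · omega
      · have := ih h; omega
    · have := ih (Finset.mem_of_mem_erase h); omega
    · rcases Finset.mem_insert.1 h with h | h
      · omega
      · have := ih (Finset.mem_of_mem_erase h); omega

/-- The total length of the blocks stored after the first `k` accesses that have identifier `y` and
satisfy `P`. -/
noncomputable def load (ops : ℕ → Access) (ids : ℕ × Bool → Ident T γ) (len : ℕ → ℕ) (k : ℕ)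
    (y : Ident T γ) (P : ℕ → Prop) : ℕ :=
  open Classical in ∑ j ∈ live ops k with ids (j, true) = y ∧ P j, len j

/-- The path evicted by some access since position `j` passes through the node of level `h` on the
path of `y`. -/
def Reached (ops : ℕ → Access) (ids : ℕ × Bool → Ident T γ) (k : ℕ) (y : Ident T γ) (h j : ℕ) :
    Prop :=
  ∃ i, j ≤ i ∧ i < k ∧ loc (ids (evictKey ops i)) h = loc y h

/-- The invariant behind the comparison with unbounded buckets. If the bucket of level `h` on the
path of `y` is not full, then all data with identifier `y` above it comes from blocks that no
eviction since their creation could have moved as deep as level `h`. Stating it for amounts of data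
rather than for blocks makes it robust against collisions of identifiers. -/
structure StashInv (Z : ℕ) (ops : ℕ → Access) (ids : ℕ × Bool → Ident T γ) (len : ℕ → ℕ) (k : ℕ)
    (s : State T γ) : Prop where
  onPath : s.OnPath
  above_le : ∀ y, ∀ h ≤ T, (s.bucket (loc y h)).size < Z →
    s.above y h ≤ load ops ids len k y fun j => ¬ Reached ops ids k y h j
  total_le : ∀ y, s.above y (T + 1) ≤ load ops ids len k y fun _ => True

theorem stashInv_empty (Z : ℕ) (ops : ℕ → Access) (ids : ℕ × Bool → Ident T γ) (len : ℕ → ℕ) :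
    StashInv Z ops ids len 0 State.empty where
  onPath := fun v y h => absurd rfl h
  above_le := fun y h _ _ => by simp [State.above, State.empty]
  total_le := fun y => by simp [State.above, State.empty]

theorem load_insert_live {ops : ℕ → Access} {ids : ℕ × Bool → Ident T γ} {len : ℕ → ℕ} {k : ℕ}
    {S : Finset ℕ} (hS : S ⊆ live ops k) (hl : live ops (k + 1) = insert k S) (y : Ident T γ)
    {P' : ℕ → Prop} (hk : P' k) :
    load ops ids len (k + 1) y P' = (if ids (k, true) = y then len k else 0) +
      (open Classical in ∑ j ∈ S with ids (j, true) = y ∧ P' j, len j) := by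
  classical
  have hkS : k ∉ S := fun h => lt_irrefl k (live_lt ops (hS h))
  rw [load, hl, Finset.filter_insert]
  split_ifs with h1 h2 h2
  · rw [Finset.sum_insert (by simp [hkS])]
  · exact absurd h1.1 h2
  · exact absurd ⟨h2, hk⟩ h1
  · rw [zero_add]

theorem load_le_sum {ops : ℕ → Access} {ids : ℕ × Bool → Ident T γ} {len : ℕ → ℕ} {k : ℕ}
    {S : Finset ℕ} {y : Ident T γ} {P P' : ℕ → Prop} (hP : ∀ j ∈ live ops k, P j → P' j)
    (hS : ∀ j ∈ live ops k, ids (j, true) = y → j ∈ S) :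
    load ops ids len k y P ≤
      (open Classical in ∑ j ∈ S with ids (j, true) = y ∧ P' j, len j) := by
  classical
  refine Finset.sum_le_sum_of_subset fun j hj => ?_
  simp only [Finset.mem_filter] at hj ⊢
  exact ⟨hS j hj.1 hj.2.1, hj.2.1, hP j hj.1 hj.2.2⟩

/-- An access evicts a path, changes the stash and writes the path back. The change of the stash is
at most the change of the stored load, except for a deleted identifier, whose path is the evicted
one and of which nothing remains but the block just stored. -/
theorem Access.Exec.exists_writeback {Z : ℕ} {ops : ℕ → Access} {ids : ℕ × Bool → Ident T γ}
    {len : ℕ → ℕ} {k : ℕ} {s s' : State T γ} (h : (ops k).Exec Z ids len k s s') :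
    ∃ s₁ : State T γ, s₁.bucket = (s.evict (ids (evictKey ops k))).bucket ∧
      Writeback Z (ids (evictKey ops k)) s₁ s' ∧
      ∀ y (P P' : ℕ → Prop), (∀ j ∈ live ops k, P j → P' j) → P' k →
        s₁.stash y + load ops ids len k y P ≤
            (s.evict (ids (evictKey ops k))).stash y + load ops ids len (k + 1) y P' ∨
          y = ids (evictKey ops k) ∧ s₁.stash y ≤ load ops ids len (k + 1) y P' := by
  classical
  unfold evictKey
  cases hop : ops k with
  | insert =>
    rw [hop] at h
    dsimp only
    refine ⟨(s.evict (ids (k, false))).put (ids (k, true)) (len k),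
      rfl, h, fun y P P' hP hk => Or.inl ?_⟩
    have hl : live ops (k + 1) = Insert.insert k (live ops k) := by simp [live, hop]
    have h1 := load_le_sum (ids := ids) (len := len) (S := live ops k) (y := y) hP fun j hj _ => hj
    rw [load_insert_live subset_rfl hl y hk]
    have h2 : ((s.evict (ids (k, false))).put (ids (k, true)) (len k)).stash y =
        (s.evict (ids (k, false))).stash y + if ids (k, true) = y then len k else 0 := by
      by_cases hy : ids (k, true) = y
      · subst hy; simp [State.put]
      · simp [State.put, Function.update_of_ne (Ne.symm hy), hy]
    rw [h2]
    omega
  | remove j =>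
    rw [hop] at h
    dsimp only
    refine ⟨(s.evict (ids (j, true))).delete (ids (j, true)),
      rfl, h, fun y P P' hP hk => ?_⟩
    have hl : live ops (k + 1) = (live ops k).erase j := by simp [live, hop]
    by_cases hy : y = ids (j, true)
    · exact Or.inr ⟨hy, by simp [State.delete, hy]⟩
    · refine Or.inl ?_
      have h1 := load_le_sum (ids := ids) (len := len) (S := (live ops k).erase j) (y := y) hP
        fun i hi he => Finset.mem_erase.2 ⟨fun h => hy (h ▸ he.symm), hi⟩
      rw [load.eq_1 ops ids len (k + 1), hl]
      simp only [State.delete, Function.update_of_ne hy]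
      exact Nat.add_le_add_left h1 _
  | update j =>
    rw [hop] at h
    dsimp only
    refine ⟨((s.evict (ids (j, true))).delete (ids (j, true))).put (ids (k, true)) (len k),
      rfl, h, fun y P P' hP hk => ?_⟩
    have hl : live ops (k + 1) = Insert.insert k ((live ops k).erase j) := by simp [live, hop]
    rw [load_insert_live (Finset.erase_subset _ _) hl y hk]
    have h2 : (((s.evict (ids (j, true))).delete (ids (j, true))).put
        (ids (k, true)) (len k)).stash y =
          ((s.evict (ids (j, true))).delete (ids (j, true))).stash y +
            if ids (k, true) = y then len k else 0 := by
      by_cases hy : ids (k, true) = y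
      · subst hy; simp [State.put]
      · simp [State.put, Function.update_of_ne (Ne.symm hy), hy]
    rw [h2]
    by_cases hy : y = ids (j, true)
    · refine Or.inr ⟨hy, ?_⟩
      simp [State.delete, hy]
    · refine Or.inl ?_
      have h1 := load_le_sum (ids := ids) (len := len) (S := (live ops k).erase j) (y := y) hP
        fun i hi he => Finset.mem_erase.2 ⟨fun h => hy (h ▸ he.symm), hi⟩
      simp only [State.delete, Function.update_of_ne hy]
      omega

theorem StashInv.exec {Z : ℕ} {ops : ℕ → Access} {ids : ℕ × Bool → Ident T γ} {len : ℕ → ℕ}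
    {k : ℕ} {s s' : State T γ} (hs : StashInv Z ops ids len k s)
    (h : (ops k).Exec Z ids len k s s') : StashInv Z ops ids len (k + 1) s' := by
  obtain ⟨s₁, hb, hw, hst⟩ := h.exists_writeback
  obtain ⟨a1, a2, a3, a4⟩ := above_of_writeback hs.onPath hb hw
  refine ⟨a1, fun y h hh hlt => ?_, fun y => ?_⟩
  · by_cases he : loc (ids (evictKey ops k)) h = loc y h
    · rw [a2 y h hh he hlt]
      exact Nat.zero_le _
    · have hv : loc y h ∉ path (ids (evictKey ops k)) := by
        intro hv
        obtain ⟨t, ht, hte⟩ := mem_path.1 hv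
        have := eq_level_of_loc_eq ht hh hte
        subst this
        exact he hte
      rw [a3 _ hv] at hlt
      have h1 := hs.above_le y h hh hlt
      have h2 := a4 y h (by omega) fun _ => he
      have h3 := hst y (fun j => ¬ Reached ops ids k y h j)
        (fun j => ¬ Reached ops ids (k + 1) y h j) ?_ ?_
      · rcases h3 with h3 | ⟨h3, -⟩
        · omega
        · exact absurd (by rw [h3]) he
      · rintro j - hj ⟨i, hi, hik, hie⟩
        rcases Nat.lt_succ_iff_lt_or_eq.1 hik with hik | rfl
        · exact hj ⟨i, hi, hik, hie⟩
        · exact he hie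
      · rintro ⟨i, hi, hik, hie⟩
        obtain rfl : i = k := by omega
        exact he hie
  · have h1 := hs.total_le y
    have h2 := a4 y (T + 1) le_rfl fun h => by omega
    rcases hst y (fun _ => True) (fun _ => True) (fun _ _ _ => trivial) trivial with h3 | ⟨h3, h4⟩
    · omega
    · -- for the deleted identifier, eviction has moved everything to the stash
      have h5 : (s.evict (ids (evictKey ops k))).stash y = s.above y (T + 1) := by
        rw [h3]; rfl
      omega

theorem IsRun.stashInv {Z : ℕ} {ops : ℕ → Access} {k : ℕ} {ids : ℕ × Bool → Ident T γ}
    {len : ℕ → ℕ} {s : ℕ → State T γ} (h : IsRun Z ops k ids len s) :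
    StashInv Z ops ids len k (s k) := by
  have : ∀ i ≤ k, StashInv Z ops ids len i (s i) := by
    intro i
    induction i with
    | zero =>
      intro _
      rw [h.1]
      exact stashInv_empty Z ops ids len
    | succ i ih => exact fun hi => (ih (by omega)).exec (h.2 i (by omega))
  exact this k le_rfl

/-! ### The tree of full buckets -/

/-- The nodes of levels `0, …, T`. -/
def nodes (T : ℕ) : Finset (List Bool) :=
  (Finset.range (T + 1)).biUnion fun t => (Finset.univ : Finset (Fin t → Bool)).image List.ofFn

theorem mem_nodes {T : ℕ} {v : List Bool} : v ∈ nodes T ↔ v.length ≤ T := by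
  simp only [nodes, Finset.mem_biUnion, Finset.mem_range, Finset.mem_image, Finset.mem_univ,
    true_and]
  constructor
  · rintro ⟨t, ht, f, rfl⟩
    simp; omega
  · intro h
    exact ⟨v.length, by omega, v.get, List.ofFn_get v⟩

/-- Rooted subtrees, possibly empty, of the complete binary tree with levels `0, …, T`. -/
def IsSubtree (T : ℕ) (τ : Finset (List Bool)) : Prop :=
  (∀ v ∈ τ, v.length ≤ T) ∧ ∀ v ∈ τ, ∀ i, v.take i ∈ τ

/-- The first level at which the path of `x` is outside of `τ`, or `T` if it stays in `τ`. -/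
def exitLevel (τ : Finset (List Bool)) (x : Ident T γ) : ℕ :=
  Nat.find (p := fun t => loc x t ∉ τ ∨ t = T) ⟨T, Or.inr rfl⟩

/-- The node at which the path of `x` leaves `τ`, or its leaf if it stays in `τ`. -/
def exitNode (τ : Finset (List Bool)) (x : Ident T γ) : List Bool := loc x (exitLevel τ x)

theorem exitLevel_le (τ : Finset (List Bool)) (x : Ident T γ) : exitLevel τ x ≤ T :=
  Nat.find_min' _ (Or.inr rfl)

theorem loc_mem_of_lt_exitLevel {τ : Finset (List Bool)} {x : Ident T γ} {t : ℕ}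
    (h : t < exitLevel τ x) : loc x t ∈ τ := by
  by_contra hn
  exact Nat.find_min _ h (Or.inl hn)

theorem exitLevel_eq_of_mem {τ : Finset (List Bool)} {x : Ident T γ} (h : exitNode τ x ∈ τ) :
    exitLevel τ x = T :=
  (Nat.find_spec (p := fun t => loc x t ∉ τ ∨ t = T) ⟨T, Or.inr rfl⟩).resolve_left (not_not.2 h)

/-- If the path of `x` leaves `τ`, then the paths through its exit node are those that leave `τ`
there. -/
theorem exitNode_eq_of_loc_eq {τ : Finset (List Bool)} {x e : Ident T γ} (hx : exitNode τ x ∉ τ)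
    (h : loc e (exitLevel τ x) = loc x (exitLevel τ x)) : exitNode τ e = exitNode τ x := by
  have : exitLevel τ e = exitLevel τ x := by
    refine (Nat.find_eq_iff _).2 ⟨Or.inl (h ▸ hx), fun t ht => ?_⟩
    have h1 := loc_mem_of_lt_exitLevel ht
    have h2 := exitLevel_le τ x
    rw [← loc_eq_of_le ht.le h] at h1
    simp only [not_or, not_not]
    exact ⟨h1, by omega⟩
  rw [exitNode, exitNode, this, h]

theorem loc_eq_of_exitNode_eq {τ : Finset (List Bool)} {x e : Ident T γ}
    (h : exitNode τ e = exitNode τ x) : loc e (exitLevel τ x) = loc x (exitLevel τ x) := by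
  have := eq_level_of_loc_eq (exitLevel_le τ e) (exitLevel_le τ x) h
  rw [← this]
  rw [exitNode, exitNode, ← this] at h
  exact h

/-- In terms of unbounded buckets, the block `j` ends in `τ`: its path never leaves `τ`, or no path
evicted at the creation of a block stored at the end leaves `τ` at the same node, from the creation
of `j` on. -/
def Stuck (ops : ℕ → Access) (ids : ℕ × Bool → Ident T γ) (k : ℕ) (τ : Finset (List Bool)) (j : ℕ) :
    Prop :=
  exitNode τ (ids (j, true)) ∈ τ ∨
    ∀ i ∈ live ops k, j ≤ i → exitNode τ (ids (evictKey ops i)) ≠ exitNode τ (ids (j, true))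

/-- For the tree `τ` of the full buckets all of whose ancestors are full, the stash and the
contents of `τ` come from blocks that even unbounded buckets would hold within `τ`. -/
theorem IsRun.exists_subtree {Z : ℕ} {ops : ℕ → Access} {k : ℕ} {ids : ℕ × Bool → Ident T γ}
    {len : ℕ → ℕ} {s : ℕ → State T γ} (h : IsRun Z ops k ids len s) :
    ∃ τ, IsSubtree T τ ∧ (s k).stash.size + τ.card * Z ≤
      (open Classical in ∑ j ∈ live ops k with Stuck ops ids k τ j, len j) := by
  classical
  have hinv := h.stashInv
  set S := s k
  set τ := (nodes T).filter fun v => ∀ i, Z ≤ (S.bucket (v.take i)).size with hτ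
  have hmem : ∀ v, v ∈ τ ↔ v.length ≤ T ∧ ∀ i, Z ≤ (S.bucket (v.take i)).size := by
    intro v; rw [hτ, Finset.mem_filter, mem_nodes]
  have hsub : IsSubtree T τ := by
    refine ⟨fun v hv => ((hmem v).1 hv).1, fun v hv i => ?_⟩
    rw [hmem] at hv ⊢
    refine ⟨le_trans (by simp) hv.1, fun i' => ?_⟩
    rw [List.take_take]
    exact hv.2 _
  refine ⟨τ, hsub, ?_⟩
  have hbucket : τ.card * Z ≤ ∑ v ∈ τ, (S.bucket v).size := by
    rw [← smul_eq_mul]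
    refine Finset.card_nsmul_le_sum _ _ _ fun v hv => ?_
    simpa using ((hmem v).1 hv).2 v.length
  -- the claim holds for each identifier separately
  have key : ∀ y, S.stash y + ∑ v ∈ τ, S.bucket v y ≤
      load ops ids len k y fun j => Stuck ops ids k τ j := by
    intro y
    have hpath : ∀ n, (∀ t ≤ T, loc y t ∈ τ → t < n) →
        S.stash y + ∑ v ∈ τ, S.bucket v y ≤ S.above y n := by
      intro n hn
      refine Nat.add_le_add_left ?_ _
      rw [← Finset.sum_filter_ne_zero]
      calc _ ≤ ∑ v ∈ (Finset.range n).image (loc y), S.bucket v y := by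
            refine Finset.sum_le_sum_of_subset fun v hv => ?_
            obtain ⟨hv, hne⟩ := Finset.mem_filter.1 hv
            obtain ⟨t, ht, rfl⟩ := hinv.onPath _ _ hne
            exact Finset.mem_image_of_mem _ (Finset.mem_range.2 (hn t ht hv))
        _ ≤ _ := Finset.sum_image_le_of_nonneg (fun _ _ => Nat.zero_le _)
    have hmono : ∀ P P' : ℕ → Prop, (∀ j ∈ live ops k, ids (j, true) = y → P j → P' j) →
        load ops ids len k y P ≤ load ops ids len k y P' := by
      intro P P' hP
      refine Finset.sum_le_sum_of_subset fun j hj => ?_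
      simp only [Finset.mem_filter] at hj ⊢
      exact ⟨hj.1, hj.2.1, hP j hj.1 hj.2.1 hj.2.2⟩
    by_cases hy : exitNode τ y ∈ τ
    · refine (hpath (T + 1) fun t ht _ => by omega).trans ((hinv.total_le y).trans ?_)
      refine hmono _ _ fun j _ hj _ => Or.inl ?_
      rwa [hj]
    · -- the path leaves `τ` at its first bucket that is not full
      have hlt : (S.bucket (loc y (exitLevel τ y))).size < Z := by
        by_contra hge
        refine hy ((hmem _).2 ⟨?_, fun i => ?_⟩)
        · rw [exitNode, length_loc y (exitLevel_le τ y)]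
          exact exitLevel_le τ y
        · rcases lt_or_ge i (exitLevel τ y) with hi | hi
          · rw [exitNode, take_loc y hi.le]
            simpa using ((hmem _).1 (loc_mem_of_lt_exitLevel hi)).2 (loc y i).length
          · rw [exitNode, List.take_of_length_le]
            · exact not_lt.1 hge
            · rwa [length_loc y (exitLevel_le τ y)]
      refine (hpath (exitLevel τ y) fun t ht htm => ?_).trans
        ((hinv.above_le y _ (exitLevel_le τ y) hlt).trans ?_)
      · by_contra hge
        refine hy ?_
        have := hsub.2 _ htm (exitLevel τ y)
        rwa [take_loc y (not_lt.1 hge)] at this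
      · refine hmono _ _ fun j _ hj hr => Or.inr fun i hi hji he => hr ⟨i, hji, live_lt ops hi, ?_⟩
        rw [hj] at he
        exact loc_eq_of_exitNode_eq he
  calc S.stash.size + τ.card * Z ≤ S.stash.size + ∑ v ∈ τ, (S.bucket v).size := by omega
    _ = ∑ y, (S.stash y + ∑ v ∈ τ, S.bucket v y) := by
      simp only [Store.size]
      rw [Finset.sum_comm, ← Finset.sum_add_distrib]
    _ ≤ ∑ y, load ops ids len k y fun j => Stuck ops ids k τ j := Finset.sum_le_sum fun y _ => key y
    _ = _ := by
      simp only [load]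
      rw [← Finset.sum_fiberwise (s := (live ops k).filter fun j => Stuck ops ids k τ j)
        (g := fun j => ids (j, true))]
      refine Finset.sum_congr rfl fun y _ => ?_
      rw [Finset.filter_filter]
      congr 1
      ext j
      simp [and_comm]

end

/-! ### Number of blocks held by a subtree -/

section Combinatorics

variable {α β : Type*} [DecidableEq β]

/-- A sequence of `n` blocks in the order of their creation is given by `ω`: the identifier of a
block and the path evicted when it is created. Their paths leave a subtree at the nodes given by
`a`. The condition says that block `j` remains in the subtree, when the nodes in `Q` are its leaves,
and only exits in `E` are taken into account. -/
def StuckAt {n : ℕ} (a : α → β) (Q E : Finset β) (ω : Fin n → α × α) (j : Fin n) : Prop :=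
  a (ω j).1 ∈ Q ∨ a (ω j).1 ∈ E ∧ ∀ i, j ≤ i → a (ω i).2 ≠ a (ω j).1

/-- Looking back in time, the path evicted for the latest block removes its exit node from the ones
at which blocks can be stuck. -/
theorem stuckAt_snoc_castSucc {n : ℕ} (a : α → β) (Q E : Finset β) (ω : Fin n → α × α) (p : α × α)
    (j : Fin n) :
    StuckAt a Q E (Fin.snoc (α := fun _ => α × α) ω p) j.castSucc ↔
      StuckAt a Q (E.erase (a p.2)) ω j := by
  simp only [StuckAt, Fin.snoc_castSucc, Fin.forall_fin_succ', Fin.snoc_last,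
    Fin.castSucc_le_castSucc_iff, Finset.mem_erase]
  have : j.castSucc ≤ Fin.last n := Fin.le_last _
  grind

theorem stuckAt_snoc_last {n : ℕ} (a : α → β) (Q E : Finset β) (ω : Fin n → α × α) (p : α × α) :
    StuckAt a Q E (Fin.snoc (α := fun _ => α × α) ω p) (Fin.last n) ↔
      a p.1 ∈ Q ∨ a p.1 ∈ E.erase (a p.2) := by
  simp only [StuckAt, Fin.forall_fin_succ', Fin.snoc_last, Finset.mem_erase]
  have : ∀ i : Fin n, ¬ Fin.last n ≤ i.castSucc := fun i => not_le.2 (Fin.castSucc_lt_last i)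
  grind

open Classical in
/-- Exponential moment of the number of stuck blocks. At an exit node, a geometric number of blocks
is stuck, since a block and an eviction are equally likely to reach it; `(1 - δ)⁻¹` is the value of
the generating function of the geometric distribution at `1 + δ`. The proof adds the blocks one by
one, going back in time. -/
theorem sum_prod_stuckAt_le [Fintype α] [Nonempty α] (a : α → β) (Q : Finset β) {δ : ℝ} (h0 : 0 ≤ δ)
    (h1 : δ < 1) (n : ℕ) (E : Finset β) (hE : Disjoint Q E) :
    ∑ ω : Fin n → α × α, ∏ j, (if StuckAt a Q E ω j then 1 + δ else 1) ≤
      (Fintype.card α : ℝ) ^ (2 * n) * (1 - δ)⁻¹ ^ E.card *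
        (1 + δ * ((Finset.univ.filter fun x => a x ∈ Q).card / Fintype.card α)) ^ n := by
  set N : ℝ := (Fintype.card α : ℝ) with hN
  have hNpos : 0 < N := by rw [hN]; exact_mod_cast Fintype.card_pos
  set q : ℝ := ((Finset.univ.filter fun x => a x ∈ Q).card : ℝ) with hq
  have hq0 : 0 ≤ q := by rw [hq]; positivity
  have hδ : 0 < 1 - δ := by linarith
  induction n generalizing E with
  | zero =>
    have : (1 : ℝ) ≤ (1 - δ)⁻¹ := by rw [one_le_inv₀ hδ]; linarith
    simpa using one_le_pow₀ this
  | succ n ih =>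
    set e : ℝ := ((Finset.univ.filter fun x => a x ∈ E).card : ℝ) with he
    have he0 : 0 ≤ e := by rw [he]; positivity
    rw [← (Fin.snocEquiv fun _ => α × α).sum_comp, Fintype.sum_prod_type]
    have hstep : ∀ p : α × α, ∑ ω : Fin n → α × α,
        ∏ j, (if StuckAt a Q E (Fin.snocEquiv (fun _ => α × α) (p, ω)) j then 1 + δ else 1) ≤
        (if a p.1 ∈ Q ∨ a p.1 ∈ E.erase (a p.2) then 1 + δ else 1) *
          (N ^ (2 * n) * (1 - δ)⁻¹ ^ (E.erase (a p.2)).card * (1 + δ * (q / N)) ^ n) := by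
      intro p
      have hsnoc : ∀ ω : Fin n → α × α, Fin.snocEquiv (fun _ => α × α) (p, ω) =
        Fin.snoc (α := fun _ => α × α) ω p := fun _ => rfl
      simp only [hsnoc, Fin.prod_univ_castSucc, stuckAt_snoc_castSucc, stuckAt_snoc_last]
      rw [← Finset.sum_mul, mul_comm]
      refine mul_le_mul_of_nonneg_left (ih _ (hE.mono_right (Finset.erase_subset _ _))) ?_
      split_ifs <;> linarith
    refine (Finset.sum_le_sum fun p _ => hstep p).trans ?_
    rw [Fintype.sum_prod_type_right]
    have hinner : ∀ y : α, ∑ x : α, (if a x ∈ Q ∨ a x ∈ E.erase (a y) then 1 + δ else 1) ≤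
        N + δ * (q + e) := by
      intro y
      calc _ ≤ ∑ x : α, (1 + δ * ((if a x ∈ Q then 1 else 0) + if a x ∈ E then 1 else 0)) := by
            refine Finset.sum_le_sum fun x _ => ?_
            simp only [Finset.mem_erase]
            split_ifs <;> first | linarith | grind
        _ = _ := by
            rw [Finset.sum_add_distrib, ← Finset.mul_sum, Finset.sum_add_distrib,
              Finset.sum_boole, Finset.sum_boole]
            simp [hN, hq, he]
    have houter : ∑ y : α, (1 - δ)⁻¹ ^ (E.erase (a y)).card = (1 - δ)⁻¹ ^ E.card * (N - δ * e) := by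
      have : ∀ y : α, (1 - δ)⁻¹ ^ (E.erase (a y)).card =
          (1 - δ)⁻¹ ^ E.card * (1 - δ * if a y ∈ E then 1 else 0) := by
        intro y
        split_ifs with hy
        · rw [← Finset.card_erase_add_one hy, pow_succ]
          field_simp
        · rw [Finset.erase_eq_of_notMem hy]; ring
      simp_rw [this]
      rw [← Finset.mul_sum, Finset.sum_sub_distrib, ← Finset.mul_sum, Finset.sum_boole]
      simp [hN, he]
    have hC : ∀ y, 0 ≤ N ^ (2 * n) * (1 - δ)⁻¹ ^ (E.erase (a y)).card * (1 + δ * (q / N)) ^ n :=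
      fun y => by positivity
    -- the factor `1 + δ * e / N` for a block at an exit in `E` is compensated by the factor
    -- `1 - δ * e / N` for an eviction that removes an exit from `E`
    calc _ ≤ ∑ y : α, (N + δ * (q + e)) *
          (N ^ (2 * n) * (1 - δ)⁻¹ ^ (E.erase (a y)).card * (1 + δ * (q / N)) ^ n) := by
          refine Finset.sum_le_sum fun y _ => ?_
          dsimp only
          rw [← Finset.sum_mul]
          exact mul_le_mul_of_nonneg_right (hinner y) (hC y)
      _ = (N + δ * (q + e)) * (N - δ * e) *
          (N ^ (2 * n) * (1 - δ)⁻¹ ^ E.card * (1 + δ * (q / N)) ^ n) := by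
          rw [← Finset.mul_sum, ← Finset.sum_mul, ← Finset.mul_sum, houter]
          ring
      _ ≤ (N ^ 2 * (1 + δ * (q / N))) *
          (N ^ (2 * n) * (1 - δ)⁻¹ ^ E.card * (1 + δ * (q / N)) ^ n) := by
          refine mul_le_mul_of_nonneg_right ?_ (by positivity)
          have : N ^ 2 * (1 + δ * (q / N)) = N ^ 2 + δ * q * N := by field_simp
          rw [this]
          nlinarith [mul_nonneg (mul_nonneg h0 h0) (mul_nonneg hq0 he0),
            mul_nonneg (mul_nonneg h0 h0) (mul_nonneg he0 he0)]
      _ = _ := by ring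

end Combinatorics

/-- The leaves of the complete binary tree of height `T` that belong to `τ`. -/
def leaves (T : ℕ) (τ : Finset (List Bool)) : Finset (List Bool) := τ.filter fun v => v.length = T

/-- The nodes outside of `τ` whose parent belongs to `τ` and is not a leaf. -/
def exits (T : ℕ) (τ : Finset (List Bool)) : Finset (List Bool) :=
  (((τ.filter fun v => v.length ≠ T) ×ˢ Finset.univ).image fun p => p.1 ++ [p.2]) \ τ

theorem disjoint_leaves_exits (T : ℕ) (τ : Finset (List Bool)) :
    Disjoint (leaves T τ) (exits T τ) :=
  Finset.disjoint_of_subset_left (Finset.filter_subset _ _) Finset.disjoint_sdiff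

theorem card_exits_add_card_leaves_le (T : ℕ) (τ : Finset (List Bool)) :
    (exits T τ).card + (leaves T τ).card ≤ 2 * τ.card := by
  have h1 : (exits T τ).card ≤ 2 * (τ.filter fun v => v.length ≠ T).card := by
    refine (Finset.card_le_card Finset.sdiff_subset).trans (Finset.card_image_le.trans ?_)
    rw [Finset.card_product, mul_comm]
    simp
  have h2 := Finset.card_filter_add_card_filter_not (s := τ) fun v => v.length = T
  simp only [leaves, ne_eq] at *
  omega

theorem exitNode_mem {T γ : ℕ} {τ : Finset (List Bool)} (hτ : [] ∈ τ) (x : Ident T γ) :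
    exitNode τ x ∈ leaves T τ ∨ exitNode τ x ∈ exits T τ := by
  by_cases hx : exitNode τ x ∈ τ
  · left
    rw [leaves, Finset.mem_filter]
    refine ⟨hx, ?_⟩
    rw [exitNode, exitLevel_eq_of_mem hx, length_loc x le_rfl]
  · right
    have hpos : exitLevel τ x ≠ 0 := by
      intro h
      rw [exitNode, h] at hx
      exact hx hτ
    obtain ⟨t, ht⟩ := Nat.exists_eq_succ_of_ne_zero hpos
    have hle := exitLevel_le τ x
    have htm : loc x t ∈ τ := loc_mem_of_lt_exitLevel (by omega)
    have hlen : t < (List.ofFn x).length := by simp; omega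
    simp only [exits, Finset.mem_sdiff, Finset.mem_image, Finset.mem_product, Finset.mem_filter,
      Finset.mem_univ, and_true]
    refine ⟨⟨(loc x t, (List.ofFn x)[t]), ⟨htm, ?_⟩, ?_⟩, hx⟩
    · rw [length_loc x (by omega)]
      omega
    · rw [exitNode, ht, loc, loc, List.take_concat_get' _ _ hlen]

/-- A leaf is the leaf of the path of at most `2 ^ (T + γ)` identifiers. -/
theorem card_loc_eq_le {T γ : ℕ} (v : List Bool) :
    (Finset.univ.filter fun x : Ident T γ => loc x T = v).card ≤ 2 ^ (T + γ) := by
  have hc : Fintype.card (Fin (T + γ) → Bool) = 2 ^ (T + γ) := by simp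
  rw [← hc, ← Finset.card_univ]
  refine Finset.card_le_card_of_injOn (fun x i => x ⟨T + i, by omega⟩) (fun _ _ => by simp) ?_
  intro x hx y hy hxy
  simp only [Finset.coe_filter, Finset.mem_univ, true_and, Set.mem_ofPred_eq] at hx hy
  funext i
  rcases lt_or_ge i.1 T with hi | hi
  · have h1 : (List.ofFn x).take T = (List.ofFn y).take T := hx.trans hy.symm
    have h2 := congrArg (fun l => l[i.1]?) h1
    simp [hi] at h2
    simpa using h2
  · have := congrFun hxy ⟨i - T, by omega⟩
    simp only at this
    have e : (⟨T + (i - T), by omega⟩ : Fin (2 * T + γ)) = i := Fin.ext (by simp; omega)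
    rwa [e] at this

theorem card_exitNode_mem_leaves_div_le {T γ : ℕ} (τ : Finset (List Bool)) :
    ((Finset.univ.filter fun x : Ident T γ => exitNode τ x ∈ leaves T τ).card : ℝ) /
      Fintype.card (Ident T γ) ≤ (leaves T τ).card / 2 ^ T := by
  have h1 : (Finset.univ.filter fun x : Ident T γ => exitNode τ x ∈ leaves T τ).card ≤
      (leaves T τ).card * 2 ^ (T + γ) := by
    refine (Finset.card_le_card (t := (leaves T τ).biUnion fun v =>
      Finset.univ.filter fun x : Ident T γ => loc x T = v) fun x hx => ?_).trans
      (Finset.card_biUnion_le_card_mul _ _ _ fun v _ => card_loc_eq_le v)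
    simp only [Finset.mem_filter, Finset.mem_univ, true_and, Finset.mem_biUnion] at hx ⊢
    refine ⟨_, hx, ?_⟩
    rw [exitNode, exitLevel_eq_of_mem (Finset.mem_filter.1 hx).1]
  have h2 : (Fintype.card (Ident T γ) : ℝ) = 2 ^ T * 2 ^ (T + γ) := by
    rw [← pow_add, Fintype.card_fun, Fintype.card_bool, Fintype.card_fin, ← add_assoc, ← two_mul]
    push_cast
    rfl
  rw [h2, div_le_div_iff₀ (by positivity) (by positivity)]
  have h3 : ((Finset.univ.filter fun x : Ident T γ => exitNode τ x ∈ leaves T τ).card : ℝ) ≤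
      (leaves T τ).card * 2 ^ (T + γ) := by exact_mod_cast h1
  calc _ ≤ (leaves T τ).card * 2 ^ (T + γ) * (2 : ℝ) ^ T := by gcongr
    _ = _ := by ring

open Classical in
/-- The exponential moment of the number of blocks that remain within a subtree, with unbounded
buckets. The leaves contribute at most the moment of a Poisson distribution, because there are at
most as many blocks as leaves. -/
theorem sum_prod_stuckAt_exitNode_le {T γ n : ℕ} (hn : n ≤ 2 ^ T) {τ : Finset (List Bool)} {δ : ℝ}
    (h0 : 0 ≤ δ) (h1 : δ < 1) :
    ∑ ω : Fin n → Ident T γ × Ident T γ,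
        ∏ j, (if StuckAt (exitNode τ) (leaves T τ) (exits T τ) ω j then 1 + δ else 1) ≤
      (Fintype.card (Ident T γ) : ℝ) ^ (2 * n) * (1 - δ)⁻¹ ^ (2 * τ.card) := by
  have hδ : 0 < 1 - δ := by linarith
  have hc : (1 : ℝ) ≤ (1 - δ)⁻¹ := by rw [one_le_inv₀ hδ]; linarith
  refine (sum_prod_stuckAt_le (exitNode τ) (leaves T τ) h0 h1 n (exits T τ)
    (disjoint_leaves_exits T τ)).trans ?_
  rw [mul_assoc]
  refine mul_le_mul_of_nonneg_left ?_ (by positivity)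
  set q := (leaves T τ).card
  have hpow : (1 + δ * (((Finset.univ.filter fun x : Ident T γ =>
      exitNode τ x ∈ leaves T τ).card : ℝ) / Fintype.card (Ident T γ))) ^ n ≤ (1 - δ)⁻¹ ^ q := by
    have hexp : Real.exp δ ≤ (1 - δ)⁻¹ := by
      rw [← inv_inv (Real.exp δ), ← Real.exp_neg]
      refine inv_anti₀ hδ ?_
      linarith [Real.add_one_le_exp (-δ)]
    calc _ ≤ (1 + δ * (q / 2 ^ T)) ^ n := by
          have := card_exitNode_mem_leaves_div_le (γ := γ) (T := T) τ
          exact pow_le_pow_left₀ (by positivity)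
            (add_le_add le_rfl (mul_le_mul_of_nonneg_left this h0)) n
      _ ≤ (Real.exp (δ * (q / 2 ^ T))) ^ n := by
          gcongr
          linarith [Real.add_one_le_exp (δ * (q / 2 ^ T))]
      _ ≤ (Real.exp (δ * (q / 2 ^ T))) ^ (2 ^ T) :=
          pow_le_pow_right₀ (Real.one_le_exp (by positivity)) hn
      _ = Real.exp δ ^ q := by
          rw [← Real.exp_nat_mul, ← Real.exp_nat_mul]
          congr 1
          push_cast
          field_simp
      _ ≤ _ := by gcongr
  calc _ ≤ (1 - δ)⁻¹ ^ (exits T τ).card * (1 - δ)⁻¹ ^ q := by gcongr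
    _ = (1 - δ)⁻¹ ^ ((exits T τ).card + q) := (pow_add _ _ _).symm
    _ ≤ _ := pow_le_pow_right₀ hc (card_exits_add_card_leaves_le T τ)

/-! ### Generating function of the subtrees -/

section

open Classical in
/-- The rooted subtrees, possibly empty, of the complete binary tree with levels `0, …, T`. -/
noncomputable def subtrees (T : ℕ) : Finset (Finset (List Bool)) :=
  (nodes T).powerset.filter fun τ => IsSubtree T τ

theorem mem_subtrees {T : ℕ} {τ : Finset (List Bool)} : τ ∈ subtrees T ↔ IsSubtree T τ := by
  simp only [subtrees, Finset.mem_filter, Finset.mem_powerset, and_iff_right_iff_imp]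
  exact fun h v hv => mem_nodes.2 (h.1 v hv)

theorem IsSubtree.nil_mem {T : ℕ} {τ : Finset (List Bool)} (h : IsSubtree T τ) (hne : τ.Nonempty) :
    [] ∈ τ := by
  obtain ⟨v, hv⟩ := hne
  simpa using h.2 v hv 0

theorem card_preimage_cons_add (τ : Finset (List Bool)) (h : [] ∈ τ) :
    τ.card = 1 + ((τ.preimage (List.cons false) (List.cons_injective.injOn)).card +
      (τ.preimage (List.cons true) (List.cons_injective.injOn)).card) := by
  classical
  rw [Finset.card_preimage, Finset.card_preimage, ← Finset.card_union_of_disjoint, add_comm 1]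
  · rw [← Finset.card_erase_add_one h]
    congr 2
    ext v
    rcases v with _ | ⟨_ | _, v⟩ <;> simp
  · rw [Finset.disjoint_left]
    intro v hv hv'
    simp only [Finset.mem_filter, Set.mem_range] at hv hv'
    obtain ⟨⟨_, u, rfl⟩, ⟨_, u', hu'⟩⟩ := And.intro hv hv'
    simp at hu'

theorem IsSubtree.preimage_cons {T : ℕ} {τ : Finset (List Bool)} (h : IsSubtree (T + 1) τ)
    (b : Bool) : IsSubtree T (τ.preimage (List.cons b) (List.cons_injective.injOn)) := by
  constructor
  · intro v hv
    have := h.1 _ (Finset.mem_preimage.1 hv)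
    simpa using this
  · intro v hv i
    have := h.2 _ (Finset.mem_preimage.1 hv) (i + 1)
    simpa using this

/-- The generating function of nonempty rooted subtrees, by number of nodes, in place of a count by
Catalan numbers: it is bounded by any `β` with `w * (1 + β) ^ 2 ≤ β`, since removing the root of a
subtree leaves two subtrees. -/
theorem sum_subtrees_le {w β : ℝ} (hw : 0 ≤ w) (hβ : 0 ≤ β) (h : w * (1 + β) ^ 2 ≤ β) (T : ℕ) :
    ∑ τ ∈ subtrees T with τ.Nonempty, w ^ τ.card ≤ β := by
  classical
  have hall : ∀ T, ∑ τ ∈ subtrees T, w ^ τ.card =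
      1 + ∑ τ ∈ subtrees T with τ.Nonempty, w ^ τ.card := by
    intro T
    rw [← Finset.sum_filter_not_add_sum_filter (s := subtrees T) (p := Finset.Nonempty)]
    congr 1
    have : (subtrees T).filter (fun τ => ¬ τ.Nonempty) = {∅} := by
      ext τ
      simp only [Finset.mem_filter, Finset.not_nonempty_iff_eq_empty, Finset.mem_singleton,
        mem_subtrees, and_iff_right_iff_imp]
      rintro rfl
      simp [IsSubtree]
    rw [this]
    simp
  induction T with
  | zero =>
    calc _ ≤ ∑ τ ∈ ({{[]}} : Finset (Finset (List Bool))), w ^ τ.card := by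
          refine Finset.sum_le_sum_of_subset_of_nonneg ?_ fun _ _ _ => by positivity
          intro τ hτ
          obtain ⟨h1, h2⟩ := Finset.mem_filter.1 hτ
          rw [mem_subtrees] at h1
          rw [Finset.mem_singleton]
          refine Finset.eq_singleton_iff_unique_mem.2 ⟨h1.nil_mem h2, fun v hv => ?_⟩
          have := h1.1 v hv
          exact List.length_eq_zero_iff.1 (by omega)
      _ = w := by simp
      _ ≤ w * (1 + β) ^ 2 := le_mul_of_one_le_right hw (one_le_pow₀ (by linarith))
      _ ≤ β := h
  | succ T ih =>
    set f : Finset (List Bool) → Finset (List Bool) × Finset (List Bool) := fun τ =>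
      (τ.preimage (List.cons false) (List.cons_injective.injOn),
        τ.preimage (List.cons true) (List.cons_injective.injOn)) with hf
    have hnil : ∀ τ ∈ (subtrees (T + 1)).filter Finset.Nonempty, [] ∈ τ := by
      intro τ hτ
      obtain ⟨h1, h2⟩ := Finset.mem_filter.1 hτ
      exact (mem_subtrees.1 h1).nil_mem h2
    have hinj : Set.InjOn f ((subtrees (T + 1)).filter Finset.Nonempty : Finset _) := by
      intro τ hτ τ' hτ' he
      have h1 := hnil τ hτ
      have h2 := hnil τ' hτ'
      simp only [hf, Prod.mk.injEq] at he
      ext v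
      rcases v with _ | ⟨_ | _, v⟩
      · simp [h1, h2]
      · have := congrArg (v ∈ ·) he.1
        simpa using this
      · have := congrArg (v ∈ ·) he.2
        simpa using this
    calc _ = ∑ τ ∈ subtrees (T + 1) with τ.Nonempty,
            w * (w ^ (f τ).1.card * w ^ (f τ).2.card) := by
          refine Finset.sum_congr rfl fun τ hτ => ?_
          rw [card_preimage_cons_add τ (hnil τ hτ), pow_add, pow_add, pow_one]
      _ = ∑ p ∈ ((subtrees (T + 1)).filter Finset.Nonempty).image f,
            w * (w ^ p.1.card * w ^ p.2.card) :=
          (Finset.sum_image (f := fun p : Finset (List Bool) × Finset (List Bool) =>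
            w * (w ^ p.1.card * w ^ p.2.card)) hinj).symm
      _ ≤ ∑ p ∈ subtrees T ×ˢ subtrees T, w * (w ^ p.1.card * w ^ p.2.card) := by
          refine Finset.sum_le_sum_of_subset_of_nonneg ?_ fun _ _ _ => by positivity
          intro p hp
          obtain ⟨τ, hτ, rfl⟩ := Finset.mem_image.1 hp
          have := mem_subtrees.1 (Finset.mem_filter.1 hτ).1
          exact Finset.mem_product.2
            ⟨mem_subtrees.2 (this.preimage_cons _), mem_subtrees.2 (this.preimage_cons _)⟩
      _ = w * (∑ τ ∈ subtrees T, w ^ τ.card) ^ 2 := by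
          rw [← Finset.mul_sum, sq, Finset.sum_mul_sum, Finset.sum_product]
      _ ≤ w * (1 + β) ^ 2 := by
          rw [hall]
          have : 0 ≤ ∑ τ ∈ subtrees T with τ.Nonempty, w ^ τ.card :=
            Finset.sum_nonneg fun _ _ => by positivity
          gcongr
      _ ≤ β := h

end

/-! ### Exponential moments of the lengths -/

open MeasureTheory ProbabilityTheory

section Moment

variable {Ω : Type*} [MeasurableSpace Ω] {μ : Measure Ω} [IsProbabilityMeasure μ]

/-- Geometric tails bound the exponential moment by that of a geometric distribution:
summing by layers, `y ^ ⌈l / B⌉ = 1 + ∑ m, (y - 1) * y ^ m` over the `m` with `m * B < l`. -/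
theorem lintegral_exp_le {l : Ω → ℕ} (hl : Measurable l) {B s : ℝ} (hB : 0 < B) (hs : 0 ≤ s)
    (hs2 : Real.exp s < 2)
    (htail : ∀ m : ℕ, 1 ≤ m → μ.real {ω | (m : ℝ) * B < (l ω : ℝ)} < (0.5 : ℝ) ^ m) :
    ∫⁻ ω, ENNReal.ofReal (Real.exp (s / B * l ω)) ∂μ ≤
      ENNReal.ofReal (Real.exp s / (2 - Real.exp s)) := by
  set y := Real.exp s with hy
  have hy1 : 1 ≤ y := Real.one_le_exp hs
  have hmeas : ∀ m : ℕ, MeasurableSet {ω | (m : ℝ) * B < (l ω : ℝ)} := fun m =>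
    measurableSet_lt measurable_const (measurable_from_top.comp hl)
  have hpt : ∀ ω, ENNReal.ofReal (Real.exp (s / B * l ω)) ≤ 1 + ∑' m : ℕ,
      {ω | (m : ℝ) * B < (l ω : ℝ)}.indicator (fun _ => ENNReal.ofReal ((y - 1) * y ^ m)) ω := by
    intro ω
    set N := ⌈(l ω : ℝ) / B⌉₊ with hN
    have h1 : Real.exp (s / B * l ω) ≤ 1 + ∑ m ∈ Finset.range N, (y - 1) * y ^ m := by
      have h2 : 1 + ∑ m ∈ Finset.range N, (y - 1) * y ^ m = y ^ N := by
        rw [← Finset.mul_sum, mul_comm, geom_sum_mul]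
        ring
      rw [h2, hy, ← Real.exp_nat_mul]
      refine Real.exp_le_exp.2 ?_
      calc s / B * l ω = (l ω / B) * s := by ring
        _ ≤ N * s := by gcongr; exact Nat.le_ceil _
    refine (ENNReal.ofReal_le_ofReal h1).trans ?_
    have hnn : ∀ m : ℕ, 0 ≤ (y - 1) * y ^ m := fun m =>
      mul_nonneg (by linarith) (by positivity)
    rw [ENNReal.ofReal_add zero_le_one (Finset.sum_nonneg fun m _ => hnn m), ENNReal.ofReal_one,
      ENNReal.ofReal_sum_of_nonneg fun m _ => hnn m]
    gcongr
    refine le_trans (Finset.sum_le_sum fun m hm => ?_) (ENNReal.sum_le_tsum (Finset.range N))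
    have : (m : ℝ) * B < l ω := by
      have := Nat.lt_ceil.1 (Finset.mem_range.1 hm)
      rwa [lt_div_iff₀ hB] at this
    rw [Set.indicator_of_mem (by exact this)]
  have hterm : ∀ m : ℕ, ∫⁻ ω, {ω | (m : ℝ) * B < (l ω : ℝ)}.indicator
      (fun _ => ENNReal.ofReal ((y - 1) * y ^ m)) ω ∂μ ≤
        ENNReal.ofReal ((y - 1) * (y / 2) ^ m) := by
    intro m
    rw [lintegral_indicator_const (hmeas m)]
    have h1 : μ {ω | (m : ℝ) * B < (l ω : ℝ)} ≤ ENNReal.ofReal ((1 / 2) ^ m) := by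
      rcases Nat.eq_zero_or_pos m with rfl | hm
      · simpa using prob_le_one
      · rw [← ofReal_measureReal]
        refine ENNReal.ofReal_le_ofReal ((htail m hm).le.trans ?_)
        norm_num
    calc _ ≤ ENNReal.ofReal ((y - 1) * y ^ m) * ENNReal.ofReal ((1 / 2) ^ m) := by gcongr
      _ = _ := by
        rw [← ENNReal.ofReal_mul (mul_nonneg (by linarith) (by positivity)), mul_assoc, ← mul_pow]
        congr 3
        ring
  calc _ ≤ ∫⁻ ω, (1 + ∑' m : ℕ, {ω | (m : ℝ) * B < (l ω : ℝ)}.indicator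
        (fun _ => ENNReal.ofReal ((y - 1) * y ^ m)) ω) ∂μ := lintegral_mono hpt
    _ = 1 + ∑' m : ℕ, ∫⁻ ω, {ω | (m : ℝ) * B < (l ω : ℝ)}.indicator
        (fun _ => ENNReal.ofReal ((y - 1) * y ^ m)) ω ∂μ := by
      rw [lintegral_add_left measurable_const,
        lintegral_tsum fun m => (measurable_const.indicator (hmeas m)).aemeasurable]
      simp
    _ ≤ 1 + ∑' m : ℕ, ENNReal.ofReal ((y - 1) * (y / 2) ^ m) := by
      gcongr with m
      exact hterm m
    _ = ENNReal.ofReal (y / (2 - y)) := by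
      have hsum : HasSum (fun m : ℕ => (y - 1) * (y / 2) ^ m) ((y - 1) * (1 - y / 2)⁻¹) :=
        (hasSum_geometric_of_lt_one (by positivity) (by linarith)).mul_left _
      rw [← ENNReal.ofReal_tsum_of_nonneg
        (fun m => mul_nonneg (by linarith) (by positivity)) hsum.summable, hsum.tsum_eq,
        ← ENNReal.ofReal_one, ← ENNReal.ofReal_add zero_le_one]
      · congr 1
        have h3 : (2 - y) ≠ 0 := by linarith
        have h4 : 1 - y / 2 = (2 - y) / 2 := by ring
        rw [h4]
        field_simp
        ring
      · exact mul_nonneg (by linarith) (inv_nonneg.2 (by linarith))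

theorem integrable_exp_and_mgf_le {l : Ω → ℕ} (hl : Measurable l) {B s : ℝ} (hB : 0 < B)
    (hs : 0 ≤ s) (hs2 : Real.exp s < 2)
    (htail : ∀ m : ℕ, 1 ≤ m → μ.real {ω | (m : ℝ) * B < (l ω : ℝ)} < (0.5 : ℝ) ^ m) :
    Integrable (fun ω => Real.exp (s / B * l ω)) μ ∧
      mgf (fun ω => (l ω : ℝ)) μ (s / B) ≤ Real.exp s / (2 - Real.exp s) := by
  have h := lintegral_exp_le (μ := μ) hl hB hs hs2 htail
  have hm : Measurable fun ω => Real.exp (s / B * l ω) :=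
    Real.measurable_exp.comp ((measurable_from_top.comp hl).const_mul _)
  constructor
  · refine ⟨hm.aestronglyMeasurable, ?_⟩
    rw [hasFiniteIntegral_iff_ofReal (Filter.Eventually.of_forall fun ω => (Real.exp_pos _).le)]
    exact h.trans_lt ENNReal.ofReal_lt_top
  · rw [mgf, integral_eq_lintegral_of_nonneg_ae
      (Filter.Eventually.of_forall fun ω => (Real.exp_pos _).le) hm.aestronglyMeasurable]
    refine ENNReal.toReal_le_of_le_ofReal ?_ h
    have := Real.exp_pos s
    exact div_nonneg this.le (by linarith)

end Moment

/-! ### Independence of the relevant identifiers -/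

section Keys

theorem live_succ_subset (ops : ℕ → Access) (k : ℕ) : live ops (k + 1) ⊆ insert k (live ops k) := by
  simp only [live]
  split
  · rfl
  · exact (Finset.erase_subset _ _).trans (Finset.subset_insert _ _)
  · exact Finset.insert_subset_insert _ (Finset.erase_subset _ _)

theorem mem_live_of_evictKey {ops : ℕ → Access} {k : ℕ} (hv : Valid ops k) {i j : ℕ} (hi : i < k)
    (h : evictKey ops i = (j, true)) : j ∈ live ops i ∧ j ∉ live ops (i + 1) := by
  have hvi := hv i hi
  unfold evictKey at h
  simp only [live]
  cases hop : ops i with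
  | insert => simp [hop] at h
  | remove j' =>
    simp only [hop, Prod.mk.injEq, and_true] at h hvi
    subst h
    simp [hvi]
  | update j' =>
    simp only [hop, Prod.mk.injEq, and_true] at h hvi
    subst h
    have := live_lt ops hvi
    simp only [Finset.mem_insert, Finset.mem_erase]
    exact ⟨hvi, by omega⟩

/-- A deleted block is never stored again. -/
theorem notMem_live_of_evictKey {ops : ℕ → Access} {k : ℕ} (hv : Valid ops k) {i j k' : ℕ}
    (hi : i < k') (hk : k' ≤ k) (h : evictKey ops i = (j, true)) : j ∉ live ops k' := by
  have h0 := mem_live_of_evictKey hv (by omega) h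
  have hji := live_lt ops h0.1
  induction k', hi using Nat.le_induction with
  | base => exact h0.2
  | succ m hm ih =>
    intro hj
    rcases Finset.mem_insert.1 (live_succ_subset ops m hj) with hj | hj
    · have := Nat.lt_of_succ_le hm
      omega
    · exact ih (by omega) hj

/-- The generated identifiers that matter for a block stored by the access at position `c.1`: its
own identifier, and the one whose path was evicted when the block was stored. -/
def blockKey (ops : ℕ → Access) (c : ℕ × Bool) : ℕ × Bool :=
  if c.2 then (c.1, true) else evictKey ops c.1

theorem evictKey_eq_of_snd_false {ops : ℕ → Access} {i : ℕ} (h : (evictKey ops i).2 = false) :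
    evictKey ops i = (i, false) := by
  unfold evictKey at *
  split <;> simp_all

/-- No identifier is used twice among the identifiers of the stored blocks and the paths evicted
when they were stored, since evicted identifiers are fresh or have just been deleted. This makes
all of them independent. -/
theorem blockKey_injOn {ops : ℕ → Access} {k : ℕ} (hv : Valid ops k) :
    Set.InjOn (blockKey ops) {c | c.1 ∈ live ops k} := by
  have hmixed : ∀ i ∈ live ops k, ∀ j ∈ live ops k, evictKey ops i ≠ (j, true) :=
    fun i hi j hj h => notMem_live_of_evictKey hv (live_lt ops hi) le_rfl h hj
  have hevict : ∀ i ∈ live ops k, ∀ j ∈ live ops k, i < j → evictKey ops i ≠ evictKey ops j := by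
    intro i hi j hj hij h
    rcases hb : (evictKey ops i).2 with _ | _
    · have h1 := evictKey_eq_of_snd_false hb
      have h2 := evictKey_eq_of_snd_false (h ▸ hb)
      rw [h1, h2] at h
      simp at h
      omega
    · have h1 : evictKey ops i = ((evictKey ops i).1, true) := by rw [← hb]
      exact notMem_live_of_evictKey hv hij (live_lt ops hj).le h1
        (mem_live_of_evictKey hv (live_lt ops hj) (h ▸ h1)).1
  rintro ⟨i, bi⟩ hi ⟨j, bj⟩ hj h
  simp only [Set.mem_ofPred_eq] at hi hj
  cases bi <;> cases bj <;> simp only [blockKey, if_true, Bool.false_eq_true, if_false] at h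
  · rcases lt_trichotomy i j with hij | hij | hij
    · exact absurd h (hevict i hi j hj hij)
    · rw [hij]
    · exact absurd h.symm (hevict j hj i hi hij)
  · exact absurd h (hmixed i hi j hj)
  · exact absurd h.symm (hmixed j hj i hi)
  · exact h

end Keys

/-! ### Union bound -/

/-- The blocks in their order of creation: their own identifiers and the evicted ones. -/
noncomputable def blockIdents {T γ : ℕ} (ops : ℕ → Access) (k : ℕ) (ids : ℕ × Bool → Ident T γ)
    (j : Fin (live ops k).card) : Ident T γ × Ident T γ :=
  (ids (blockKey ops ((live ops k).orderEmbOfFin rfl j, true)),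
    ids (blockKey ops ((live ops k).orderEmbOfFin rfl j, false)))

theorem Stuck.stuckAt {T γ : ℕ} {ops : ℕ → Access} {k : ℕ} {ids : ℕ × Bool → Ident T γ}
    {τ : Finset (List Bool)} (hτ : [] ∈ τ) {j : Fin (live ops k).card}
    (h : Stuck ops ids k τ ((live ops k).orderEmbOfFin rfl j)) :
    StuckAt (exitNode τ) (leaves T τ) (exits T τ) (blockIdents ops k ids) j := by
  rcases exitNode_mem hτ (blockIdents ops k ids j).1 with hl | he
  · exact Or.inl hl
  · refine Or.inr ⟨he, fun i hi => ?_⟩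
    rcases h with h | h
    · exact absurd h (Finset.mem_sdiff.1 he).2
    · exact h _ (Finset.orderEmbOfFin_mem _ rfl i)
        ((Finset.orderEmbOfFin _ rfl).monotone hi)

open Classical in
theorem sum_stuck_le {T γ : ℕ} {ops : ℕ → Access} {k : ℕ} {ids : ℕ × Bool → Ident T γ}
    {τ : Finset (List Bool)} (hτ : [] ∈ τ) (len : ℕ → ℕ) :
    ∑ j ∈ live ops k with Stuck ops ids k τ j, len j ≤
      ∑ j with StuckAt (exitNode τ) (leaves T τ) (exits T τ) (blockIdents ops k ids) j,
        len ((live ops k).orderEmbOfFin rfl j) := by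
  conv_lhs => rw [← Finset.map_orderEmbOfFin_univ (live ops k) rfl]
  rw [Finset.filter_map, Finset.sum_map]
  refine Finset.sum_le_sum_of_subset fun j hj => ?_
  simp only [Finset.mem_filter, Finset.mem_univ, true_and, Function.comp_apply] at hj ⊢
  exact Stuck.stuckAt hτ hj

theorem measure_preimage_singleton_of_uniform {Ω : Type*} [MeasurableSpace Ω] {μ : Measure Ω}
    {α : Type*} [Fintype α] [Nonempty α] [MeasurableSpace α] [MeasurableSingletonClass α]
    {X : Ω → α} (hX : Measurable X)
    (hu : μ.map X = (PMF.uniformOfFintype α).toMeasure) (x : α) :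
    μ (X ⁻¹' {x}) = (Fintype.card α : ENNReal)⁻¹ := by
  rw [← Measure.map_apply hX (measurableSet_singleton x), hu,
    PMF.toMeasure_apply_singleton _ _ (measurableSet_singleton x), PMF.uniformOfFintype_apply]

section Probability

variable {Ω : Type*} [MeasurableSpace Ω] {μ : Measure Ω} [IsProbabilityMeasure μ]

omit [IsProbabilityMeasure μ] in
/-- The identifiers of the stored blocks and those evicted at their creation are independent and
uniform, and independent of the lengths. -/
theorem measureReal_blockIdents_inter {T γ : ℕ} {ops : ℕ → Access} {k : ℕ} (hvalid : Valid ops k)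
    {ids : ℕ × Bool → Ω → Ident T γ} (hids : ∀ c, Measurable (ids c))
    (hids_unif : ∀ c, μ.map (ids c) = (PMF.uniformOfFintype (Ident T γ)).toMeasure)
    (hids_indep : iIndepFun ids μ) {len : ℕ → Ω → ℕ}
    (hindep : IndepFun (fun ω c => ids c ω) (fun ω i => len i ω) μ)
    (v : Fin (live ops k).card → Ident T γ × Ident T γ) {A : Set (ℕ → ℕ)} (hA : MeasurableSet A) :
    μ.real ({ω | blockIdents ops k (fun c => ids c ω) = v} ∩ {ω | (fun i => len i ω) ∈ A}) =
      ((Fintype.card (Ident T γ) : ℝ) ^ (2 * (live ops k).card))⁻¹ *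
        μ.real {ω | (fun i => len i ω) ∈ A} := by
  set e := (live ops k).orderEmbOfFin rfl with he
  set key : Fin (live ops k).card × Bool → ℕ × Bool := fun c => blockKey ops (e c.1, c.2) with hkey
  set g : Fin (live ops k).card × Bool → Ident T γ :=
    fun c => if c.2 then (v c.1).1 else (v c.1).2 with hg
  have hkinj : Function.Injective key := by
    intro c c' h
    have := blockKey_injOn hvalid (Finset.orderEmbOfFin_mem _ rfl c.1)
      (Finset.orderEmbOfFin_mem _ rfl c'.1) h
    simp only [Prod.mk.injEq, EmbeddingLike.apply_eq_iff_eq] at this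
    exact Prod.ext this.1 this.2
  have hset : {ω | blockIdents ops k (fun c => ids c ω) = v} = ⋂ c, ids (key c) ⁻¹' {g c} := by
    ext ω
    simp only [Set.mem_ofPred_eq, Set.mem_iInter, Set.mem_preimage, Set.mem_singleton_iff,
      Prod.forall, Bool.forall_bool, hg, hkey, funext_iff, blockIdents, Prod.ext_iff]
    grind
  have hprod : μ (⋂ c, ids (key c) ⁻¹' {g c}) =
      (Fintype.card (Ident T γ) : ENNReal)⁻¹ ^ (2 * (live ops k).card) := by
    rw [(hids_indep.precomp hkinj).meas_iInter fun c => ⟨{g c}, measurableSet_singleton _, rfl⟩]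
    simp_rw [measure_preimage_singleton_of_uniform (hids _) (hids_unif _)]
    simp [Finset.prod_const, mul_comm]
  have hmeas : MeasurableSet (⋂ c, {f : ℕ × Bool → Ident T γ | f (key c) = g c}) :=
    by
    refine MeasurableSet.iInter fun c => ?_
    have hc : Measurable fun f : ℕ × Bool → Ident T γ => f (key c) := measurable_pi_apply _
    exact hc (measurableSet_singleton (g c))
  have hmul := hindep.measure_inter_preimage_eq_mul _ _ hmeas hA
  have hpre : (fun ω c => ids c ω) ⁻¹' (⋂ c, {f : ℕ × Bool → Ident T γ | f (key c) = g c}) =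
      ⋂ c, ids (key c) ⁻¹' {g c} := by
    ext ω
    simp
  rw [hpre, hprod] at hmul
  rw [hset, measureReal_def, measureReal_def]
  have : {ω | (fun i => len i ω) ∈ A} = (fun ω i => len i ω) ⁻¹' A := rfl
  rw [this, hmul, ENNReal.toReal_mul]
  simp

/-- Chernoff's bound for the total length of a set of stored blocks. -/
theorem measureReal_lt_sum_le {ops : ℕ → Access} {k : ℕ} {len : ℕ → Ω → ℕ}
    (hlen : ∀ i, Measurable (len i)) {B s : ℝ} (hB : 0 < B) (hs : 0 ≤ s) (hs2 : Real.exp s < 2)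
    (htail : ∀ i, ∀ m : ℕ, 1 ≤ m → μ.real {ω | (m : ℝ) * B < (len i ω : ℝ)} < (0.5 : ℝ) ^ m)
    (hlen_indep : iIndepFun (fun (i : live ops k) ω => len i ω) μ)
    (S : Finset (Fin (live ops k).card)) (a : ℝ) :
    μ.real {ω | a * B < ((∑ j ∈ S, len ((live ops k).orderEmbOfFin rfl j) ω : ℕ) : ℝ)} ≤
      Real.exp (-(s * a)) * (Real.exp s / (2 - Real.exp s)) ^ S.card := by
  set e := (live ops k).orderEmbOfFin rfl with he
  set X : Fin (live ops k).card → Ω → ℝ := fun j ω => (len (e j) ω : ℝ) with hX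
  have hXm : ∀ j, Measurable (X j) := fun j => measurable_from_top.comp (hlen _)
  have hXi : iIndepFun X μ := by
    have hinj : Function.Injective fun j : Fin (live ops k).card =>
        (⟨e j, Finset.orderEmbOfFin_mem _ rfl j⟩ : live ops k) := by
      intro i j h
      simpa using h
    exact (hlen_indep.precomp hinj).comp (fun _ (n : ℕ) => (n : ℝ)) fun _ => measurable_from_top
  have hmgf := fun j => integrable_exp_and_mgf_le (μ := μ) (hlen (e j)) hB hs hs2 (htail (e j))
  have hint := hXi.integrable_exp_mul_sum hXm (s := S) (t := s / B) fun j _ => (hmgf j).1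
  calc _ ≤ μ.real {ω | a * B ≤ (∑ j ∈ S, X j) ω} := by
        refine measureReal_mono (fun ω hω => ?_) (measure_ne_top _ _)
        simp only [Set.mem_ofPred_eq, Finset.sum_apply, hX] at hω ⊢
        push_cast at hω
        exact hω.le
    _ ≤ Real.exp (-(s / B) * (a * B)) * mgf (∑ j ∈ S, X j) μ (s / B) :=
        measure_ge_le_exp_mul_mgf _ (by positivity) hint
    _ ≤ _ := by
        have h1 : -(s / B) * (a * B) = -(s * a) := by field_simp
        rw [h1, hXi.mgf_sum hXm]
        gcongr
        rw [← Finset.prod_const]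
        exact Finset.prod_le_prod (fun j _ => mgf_nonneg) fun j _ => (hmgf j).2

open Classical in
/-- The probability that a given subtree causes a large stash. -/
theorem measureReal_subtree_le {T γ : ℕ} {ops : ℕ → Access} {k : ℕ} (hvalid : Valid ops k)
    (hcap : (live ops k).card ≤ 2 ^ T)
    {ids : ℕ × Bool → Ω → Ident T γ} (hids : ∀ c, Measurable (ids c))
    (hids_unif : ∀ c, μ.map (ids c) = (PMF.uniformOfFintype (Ident T γ)).toMeasure)
    (hids_indep : iIndepFun ids μ) {len : ℕ → Ω → ℕ}
    (hlen : ∀ i, Measurable (len i)) {B s : ℝ} (hB : 0 < B) (hs : 0 ≤ s)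
    {δ : ℝ} (hδ1 : δ < 1) (hs2 : Real.exp s < 2)
    (hδ : Real.exp s / (2 - Real.exp s) = 1 + δ)
    (htail : ∀ i, ∀ m : ℕ, 1 ≤ m → μ.real {ω | (m : ℝ) * B < (len i ω : ℝ)} < (0.5 : ℝ) ^ m)
    (hlen_indep : iIndepFun (fun (i : live ops k) ω => len i ω) μ)
    (hindep : IndepFun (fun ω c => ids c ω) (fun ω i => len i ω) μ)
    {τ : Finset (List Bool)} (hτ : [] ∈ τ) (a : ℝ) :
    μ.real {ω | a * B <
        ((∑ j ∈ live ops k with Stuck ops (fun c => ids c ω) k τ j, len j ω : ℕ) : ℝ)} ≤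
      Real.exp (-(s * a)) * (1 - δ)⁻¹ ^ (2 * τ.card) := by
  set n := (live ops k).card with hn
  set e := (live ops k).orderEmbOfFin rfl with he
  set N : ℝ := (Fintype.card (Ident T γ) : ℝ) with hN
  have hNpos : 0 < N := by rw [hN]; exact_mod_cast Fintype.card_pos
  have hδ0 : 0 ≤ δ := by
    have h1 := Real.one_le_exp hs
    have h2 : 1 ≤ Real.exp s / (2 - Real.exp s) := by
      rw [le_div_iff₀ (by linarith)]
      linarith
    linarith
  -- the blocks that are stuck when the identifiers are `v`
  set S : (Fin n → Ident T γ × Ident T γ) → Finset (Fin n) := fun v =>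
    Finset.univ.filter fun j => StuckAt (exitNode τ) (leaves T τ) (exits T τ) v j with hS
  set A : (Fin n → Ident T γ × Ident T γ) → Set (ℕ → ℕ) := fun v =>
    {f | a * B < ((∑ j ∈ S v, f (e j) : ℕ) : ℝ)} with hA
  have hAm : ∀ v, MeasurableSet (A v) := by
    intro v
    refine measurableSet_lt measurable_const (measurable_from_top.comp ?_)
    exact Finset.measurable_sum _ fun j _ => measurable_pi_apply _
  calc _ ≤ μ.real (⋃ v ∈ (Finset.univ : Finset (Fin n → Ident T γ × Ident T γ)),
          ({ω | blockIdents ops k (fun c => ids c ω) = v} ∩ {ω | (fun i => len i ω) ∈ A v})) := by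
        refine measureReal_mono (fun ω hω => ?_) (measure_ne_top _ _)
        simp only [Set.mem_iUnion, Finset.mem_univ, exists_true_left]
        refine ⟨blockIdents ops k (fun c => ids c ω), rfl, ?_⟩
        refine lt_of_lt_of_le (show a * B < _ from hω) ?_
        exact_mod_cast sum_stuck_le hτ fun i => len i ω
    _ ≤ ∑ v : Fin n → Ident T γ × Ident T γ, (N ^ (2 * n))⁻¹ *
          (Real.exp (-(s * a)) * (1 + δ) ^ (S v).card) := by
        refine (measureReal_biUnion_finset_le _ _).trans (Finset.sum_le_sum fun v _ => ?_)
        rw [measureReal_blockIdents_inter hvalid hids hids_unif hids_indep hindep v (hAm v), ← hδ]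
        refine mul_le_mul_of_nonneg_left ?_ (by positivity)
        exact measureReal_lt_sum_le hlen hB hs hs2 htail hlen_indep (S v) a
    _ = Real.exp (-(s * a)) * (N ^ (2 * n))⁻¹ * ∑ v : Fin n → Ident T γ × Ident T γ,
          ∏ j, (if StuckAt (exitNode τ) (leaves T τ) (exits T τ) v j then 1 + δ else 1) := by
        rw [Finset.mul_sum]
        refine Finset.sum_congr rfl fun v _ => ?_
        rw [Finset.prod_ite, Finset.prod_const_one, Finset.prod_const, mul_one]
        ring
    _ ≤ Real.exp (-(s * a)) * (N ^ (2 * n))⁻¹ * (N ^ (2 * n) * (1 - δ)⁻¹ ^ (2 * τ.card)) := by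
        refine mul_le_mul_of_nonneg_left ?_ (by positivity)
        exact sum_prod_stuckAt_exitNode_le hcap hδ0 hδ1
    _ = _ := by
        field_simp

end Probability

/-- The tail bound for positive mean length; the sum over all subtrees contributes the constant
`0.35`. -/
theorem measureReal_stash_le {Ω : Type*} [MeasurableSpace Ω] (μ : Measure Ω)
    [IsProbabilityMeasure μ]
    (T γ Z : ℕ) (B : ℝ) (hZ : 20 * B ≤ (Z : ℝ))
    (ops : ℕ → Access) (k : ℕ) (hvalid : Valid ops k)
    (hcap : (live ops k).card ≤ 2 ^ T)
    (ids : ℕ × Bool → Ω → Ident T γ) (hids : ∀ c, Measurable (ids c))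
    (hids_unif : ∀ c, μ.map (ids c) = (PMF.uniformOfFintype (Ident T γ)).toMeasure)
    (hids_indep : iIndepFun ids μ)
    (len : ℕ → Ω → ℕ) (hlen : ∀ i, Measurable (len i))
    (hlen_tail : ∀ i, ∀ m : ℕ, 1 ≤ m → μ.real {ω | (m : ℝ) * B < (len i ω : ℝ)} < (0.5 : ℝ) ^ m)
    (hlen_indep : iIndepFun (fun (i : live ops k) ω => len i ω) μ)
    (hindep : IndepFun (fun ω c => ids c ω) (fun ω i => len i ω) μ)
    (s : ℕ → Ω → State T γ)
    (hrun : ∀ ω, IsRun Z ops k (fun c => ids c ω) (fun i => len i ω) (fun i => s i ω))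
    (hB : 0 < B) (R : ℝ) (hR : 0 ≤ R) :
    μ.real {ω | R * B < ((s k ω).stash.size : ℝ)} ≤ 0.35 * (0.883 : ℝ) ^ R := by
  classical
  set t := -Real.log 0.883 with ht
  have ht0 : 0 ≤ t := by
    rw [ht, neg_nonneg]
    exact Real.log_nonpos (by norm_num) (by norm_num)
  have hexp : Real.exp t = 1000 / 883 := by
    rw [ht, Real.exp_neg, Real.exp_log (by norm_num)]
    norm_num
  have hρ : ∀ a : ℝ, Real.exp (-(t * a)) = (0.883 : ℝ) ^ a := by
    intro a
    rw [Real.rpow_def_of_pos (by norm_num), ht]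
    congr 1
    ring
  -- `1 + δ = exp t / (2 - exp t)` bounds the exponential moment of a length at `t / B`
  set δ : ℝ := 234 / 766 with hδ
  calc _ ≤ μ.real (⋃ τ ∈ (subtrees T).filter Finset.Nonempty,
          {ω | (R + 20 * τ.card) * B <
            ((∑ j ∈ live ops k with Stuck ops (fun c => ids c ω) k τ j, len j ω : ℕ) : ℝ)}) := by
        refine measureReal_mono (fun ω hω => ?_) (measure_ne_top _ _)
        obtain ⟨τ, hτ, hle⟩ := (hrun ω).exists_subtree
        have hle' : ((s k ω).stash.size : ℝ) + τ.card * Z ≤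
            ((∑ j ∈ live ops k with Stuck ops (fun c => ids c ω) k τ j, len j ω : ℕ) : ℝ) := by
          exact_mod_cast hle
        have hω' : R * B < ((s k ω).stash.size : ℝ) := hω
        have hne : τ.Nonempty := by
          rw [Finset.nonempty_iff_ne_empty]
          rintro rfl
          -- all paths leave the empty tree at the root, also the one evicted with the block
          have hnot : ∀ j ∈ live ops k, ¬ Stuck ops (fun c => ids c ω) k ∅ j := by
            intro j hj h
            rcases h with h | h
            · simp at h
            · exact h j hj le_rfl (exitNode_eq_of_loc_eq (by simp)
                (loc_eq_of_le (Nat.find_min' _ (Or.inl (by simp))) (t := 0) rfl))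
          rw [Finset.filter_false_of_mem hnot] at hle'
          simp only [Finset.sum_empty, Finset.card_empty] at hle'
          have : 0 ≤ R * B := by positivity
          norm_num at hle'
          rw [hle'] at hω'
          norm_num at hω'
          linarith
        simp only [Set.mem_iUnion]
        refine ⟨τ, Finset.mem_filter.2 ⟨mem_subtrees.2 hτ, hne⟩, ?_⟩
        show (R + 20 * τ.card) * B < _
        have : (τ.card : ℝ) * (20 * B) ≤ τ.card * Z := by gcongr
        linarith
    _ ≤ ∑ τ ∈ (subtrees T).filter Finset.Nonempty,
          (0.883 : ℝ) ^ R * ((0.883 : ℝ) ^ 20 * (1 - δ)⁻¹ ^ 2) ^ τ.card := by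
        refine (measureReal_biUnion_finset_le _ _).trans (Finset.sum_le_sum fun τ hτ => ?_)
        obtain ⟨hτ1, hτ2⟩ := Finset.mem_filter.1 hτ
        refine (measureReal_subtree_le hvalid hcap hids hids_unif hids_indep hlen hB ht0
          (δ := δ) (by rw [hδ]; norm_num) (by rw [hexp]; norm_num) (by rw [hexp, hδ]; norm_num)
          hlen_tail hlen_indep hindep ((mem_subtrees.1 hτ1).nil_mem hτ2) _).trans_eq ?_
        rw [hρ, Real.rpow_add (by norm_num), mul_pow, ← pow_mul, ← pow_mul, mul_assoc]
        congr 2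
        rw [← Real.rpow_natCast]
        push_cast
        rfl
    _ ≤ _ := by
        rw [← Finset.mul_sum, mul_comm]
        gcongr
        -- the weight of a node is less than `0.173`, and `0.173 * 1.35 ^ 2 ≤ 0.35`
        refine sum_subtrees_le (by positivity) (by norm_num) ?_ T
        rw [hδ]
        norm_num

end VORAM

theorem mainTheorem1 {Ω : Type*} [MeasurableSpace Ω] (μ : MeasureTheory.Measure Ω)
    [MeasureTheory.IsProbabilityMeasure μ]
    (T γ Z : ℕ) (B : ℝ) (hZ : 20 * B ≤ (Z : ℝ))
    -- the sequence of accesses; at most `2 ^ T` blocks are stored after the first `k` of them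
    (ops : ℕ → VORAM.Access) (k : ℕ) (hvalid : VORAM.Valid ops k)
    (hcap : (VORAM.live ops k).card ≤ 2 ^ T)
    -- the generated identifiers are independent and uniform
    (ids : ℕ × Bool → Ω → VORAM.Ident T γ) (hids : ∀ c, Measurable (ids c))
    (hids_unif : ∀ c, μ.map (ids c) = (PMF.uniformOfFintype (VORAM.Ident T γ)).toMeasure)
    (hids_indep : ProbabilityTheory.iIndepFun ids μ)
    -- block lengths
    (len : ℕ → Ω → ℕ) (hlen : ∀ i, Measurable (len i))
    (hlen_int : ∀ i, MeasureTheory.Integrable (fun ω => (len i ω : ℝ)) μ)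
    (hlen_mean : ∀ i, ∫ ω, (len i ω : ℝ) ∂μ = B)
    (hlen_tail : ∀ i, ∀ m : ℕ, 1 ≤ m → μ.real {ω | (m : ℝ) * B < (len i ω : ℝ)} < (0.5 : ℝ) ^ m)
    -- the lengths of the blocks that are stored at the same time are independent
    (hlen_indep : ProbabilityTheory.iIndepFun (fun (i : VORAM.live ops k) ω => len i ω) μ)
    (hindep : ProbabilityTheory.IndepFun (fun ω c => ids c ω) (fun ω i => len i ω) μ)
    -- the execution, for any way of resolving the arbitrary choices in `writeback`
    (s : ℕ → Ω → VORAM.State T γ)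
    (hrun : ∀ ω, VORAM.IsRun Z ops k (fun c => ids c ω) (fun i => len i ω) (fun i => s i ω))
    (R : ℝ) (hR : 1 ≤ R) :
    μ.real {ω | R * B < ((s k ω).stash.size : ℝ)} < 28 * (0.883 : ℝ) ^ R := by

  classical
  have hB0 : 0 ≤ B := by
    rw [← hlen_mean 0]
    exact MeasureTheory.integral_nonneg fun ω => Nat.cast_nonneg _
  have hpos : (0 : ℝ) < (0.883 : ℝ) ^ R := Real.rpow_pos_of_pos (by norm_num) R
  rcases hB0.eq_or_lt with hB | hB
  · -- all lengths vanish almost surely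
    have hzero : ∀ᵐ ω ∂μ, ∀ i, len i ω = 0 := by
      rw [MeasureTheory.ae_all_iff]
      intro i
      have h := (MeasureTheory.integral_eq_zero_iff_of_nonneg
        (fun ω => Nat.cast_nonneg (len i ω)) (hlen_int i)).1 ((hlen_mean i).trans hB.symm)
      filter_upwards [h] with ω hω
      simpa using hω
    have hnull : μ {ω | R * B < ((s k ω).stash.size : ℝ)} = 0 := by
      refine MeasureTheory.measure_mono_null (fun ω hω => ?_) (MeasureTheory.ae_iff.1 hzero)
      intro h0
      obtain ⟨τ, -, hle⟩ := (hrun ω).exists_subtree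
      have hω' : R * B < ((s k ω).stash.size : ℝ) := hω
      rw [Finset.sum_eq_zero fun j _ => h0 j] at hle
      have : (s k ω).stash.size = 0 := by omega
      rw [this, ← hB] at hω'
      norm_num at hω'
    rw [MeasureTheory.measureReal_def, hnull]
    norm_num
    positivity
  · have h := VORAM.measureReal_stash_le μ T γ Z B hZ ops k hvalid hcap ids hids hids_unif hids_indep
      len hlen hlen_tail hlen_indep hindep s hrun hB R (by linarith)
    linarith
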